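/- There is a universal constant $C>0$ such that the following holds for all integers $n \ge 0$, $D\ge 0$ and $d>0$. Let $A_1,\dots,A_n\in\mathbb R^{D\times D}$ be symmetric with $\operatorname{Tr}A_i=0$ for every $i$, let $A=\sum_{i=1}^n A_i^2$, let $y\in\mathbb R^D$ be a unit vector (in the Euclidean norm), and let $S\in\mathbb R^{d\times D}$ be a random matrix whose entries are independent with distribution $\mathcal N(0,1/d)$. Write $\langle M,N\rangle=\operatorname{Tr}(MN)$ for the inner product of symmetric matrices and $\|M\|$ for the spectral (operator) norm. Then all the moments below exist, and: 1. (Expectation) For every $i$, $\;\mathbb E\,\langle (Sy)(Sy)^\top, SA_iS^\top\rangle=\left(1+\tfrac1d\right)\langle yy^\top,A_i\rangle$. 2. (Variance) $\;\displaystyle\sum_{i=1}^n\operatorname{Var}\left[\langle (Sy)(Sy)^\top, SA_iS^\top\rangle\right]\le C\left(\frac{\|A\|}{d}+\frac{\operatorname{Tr}A}{d^2}\right)$. 3. (Spectral norm) $\;\displaystyle\mathbb E\left\|\sum_{i=1}^n (SA_iS^\top)^2\right\|\le C\left(\|A\|+\frac{\operatorname{Tr}A}{d}\right)$. -/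

import Mathlib

open MeasureTheory ProbabilityTheory
open scoped Matrix NNReal

/-- The spectral (operator) norm of a real square matrix: the norm of the linear operator it
induces on Euclidean space. -/
noncomputable def specNorm {m : ℕ} (M : Matrix (Fin m) (Fin m) ℝ) : ℝ :=
  ‖Matrix.toEuclideanCLM (n := Fin m) (𝕜 := ℝ) M‖

/-- The inner product `⟨A, B⟩ = Tr (A B)` of (symmetric) matrices. -/
def matInner {m : ℕ} (A B : Matrix (Fin m) (Fin m) ℝ) : ℝ := (A * B).trace

/-- The rank-one matrix `x xᵀ`. -/
def outerSelf {m : ℕ} (x : Fin m → ℝ) : Matrix (Fin m) (Fin m) ℝ := Matrix.vecMulVec x x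

/-- A random `d × D` matrix whose entries are independent and all have law `N(0, 1/d)`. -/
structure IsGaussianSketch {Ω : Type*} [MeasurableSpace Ω] (μ : Measure Ω) {d D : ℕ}
    (S : Ω → Matrix (Fin d) (Fin D) ℝ) : Prop where
  hasLaw : ∀ (j : Fin d) (k : Fin D),
    HasLaw (fun ω => S ω j k) (gaussianReal 0 (1 / (d : ℝ≥0))) μ
  indep : iIndepFun (fun (p : Fin d × Fin D) (ω : Ω) => S ω p.1 p.2) μ

/-- The sketched quadratic form `⟨(S y)(S y)ᵀ, S A Sᵀ⟩`. -/
def sketchForm {d D : ℕ} (A : Matrix (Fin D) (Fin D) ℝ) (y : EuclideanSpace ℝ (Fin D))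
    (S : Matrix (Fin d) (Fin D) ℝ) : ℝ :=
  matInner (outerSelf (S *ᵥ y.ofLp)) (S * A * Sᵀ)

/-! All quantities are homogeneous of degree four in `S`, so with `X = √d S` standard Gaussian they
only pick up a factor `1 / d²`. Everything rests on Gaussian integration by parts for polynomials.
For `q = xᵀBx` with `B` symmetric it gives the recursion `E q^(p+1) = tr B · E q^p + 2p · E[q^(p-1)
xᵀB²x]` (`integral_quadForm_pow_succ`), hence `E q^p ≤ (tr B + 2pb)^p` when `B ≥ 0` and `B² ≤ bB`.

Expectation and variance: let `g = Xy`, `P = 1 - yyᵀ` and `a = yᵀAy`, where `A` is one of the `Aᵢ`.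
The part of `X` orthogonal to `y` is independent of `g` and may be replaced by that of an
independent copy `H`. With `q = Hᵀg` the form becomes `‖g‖⁴ a + 2‖g‖² ⟨PAy, q⟩ + qᵀPAPq`
(`sketchQuad_resample`). For fixed `g` these terms are constant, linear and quadratic in `H`, and
`tr PAP = -a` because `tr A = 0`. What remains is moments of `‖g‖²` up to the fourth.

Spectral norm: let `N = ∑ (X Aᵢ Xᵀ)²`. For a Gaussian vector `u`, `p! ‖N‖^p ≤ E_u (uᵀNu)^p`
(`specNorm_pow_mul_factorial_le`). This is used with `p = d` and the order of integration exchanged.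
For fixed `u`, `uᵀNu` is the squared norm of the chaos `(X Aᵢ Xᵀu)ᵢ`, which is centered because `tr
Aᵢ = 0`. Decoupling (`integral_bilin_self_pow_le`) replaces it by `(X Aᵢ Yᵀu)ᵢ` with `Y` independent
of `X`, at the cost of `4^d`. Integrating over `X`, `Y` and `u` in turn by the moment bound leaves
powers of `d` that `d!` absorbs, since `d^d ≤ 3^d d!`. Taking `d`-th roots loses only a constant, as
the exponent equals the dimension. -/

/-- The standard Gaussian measure on `ι → ℝ`. -/
noncomputable abbrev stdGauss (ι : Type*) [Fintype ι] : Measure (ι → ℝ) :=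
  Measure.pi fun _ : ι => gaussianReal 0 1

/-- `f` has finite moments of every order. -/
def HasMoments {Ω : Type*} [MeasurableSpace Ω] (f : Ω → ℝ) (μ : Measure Ω) : Prop :=
  ∀ p : ℕ, MemLp f p μ

/-! ### Functions with all moments form an algebra. -/

namespace HasMoments

variable {Ω : Type*} [MeasurableSpace Ω] {μ : Measure Ω} {f g : Ω → ℝ}

theorem integrable (hf : HasMoments f μ) : Integrable f μ := by
  simpa [memLp_one_iff_integrable] using hf 1

theorem memLp_two (hf : HasMoments f μ) : MemLp f 2 μ := by simpa using hf 2

theorem const [IsFiniteMeasure μ] (c : ℝ) : HasMoments (fun _ => c) μ := fun _ => memLp_const c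

theorem add (hf : HasMoments f μ) (hg : HasMoments g μ) : HasMoments (fun x => f x + g x) μ :=
  fun p => (hf p).add (hg p)

theorem sub (hf : HasMoments f μ) (hg : HasMoments g μ) : HasMoments (fun x => f x - g x) μ :=
  fun p => (hf p).sub (hg p)

theorem mul (hf : HasMoments f μ) (hg : HasMoments g μ) : HasMoments (fun x => f x * g x) μ := by
  intro p
  -- Cauchy–Schwarz: the `p`-th moment of a product needs the `2p`-th moments of the factors.
  have : ENNReal.HolderTriple ((2 * p : ℕ) : ENNReal) ((2 * p : ℕ) : ENNReal) (p : ENNReal) := by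
    constructor
    push_cast
    rw [ENNReal.mul_inv (by simp) (by simp), ← add_mul, ENNReal.inv_two_add_inv_two, one_mul]
  exact (hg (2 * p)).mul (hf (2 * p))

theorem const_mul (hf : HasMoments f μ) (c : ℝ) : HasMoments (fun x => c * f x) μ :=
  fun p => (hf p).const_mul c

theorem pow [IsFiniteMeasure μ] (hf : HasMoments f μ) (n : ℕ) :
    HasMoments (fun x => f x ^ n) μ := by
  induction n with
  | zero => simpa using const (μ := μ) 1
  | succ n ih => simpa only [pow_succ] using ih.mul hf

theorem sum {α : Type*} (s : Finset α) {F : α → Ω → ℝ} (h : ∀ a, HasMoments (F a) μ) :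
    HasMoments (fun x => ∑ a ∈ s, F a x) μ :=
  fun p => memLp_finsetSum s fun a _ => h a p

theorem comp {Ω' : Type*} [MeasurableSpace Ω'] {ν : Measure Ω'} {φ : Ω' → Ω}
    (hf : HasMoments f μ) (hφ : MeasurePreserving φ ν μ) : HasMoments (fun x => f (φ x)) ν :=
  fun p => (hf p).comp_measurePreserving hφ

theorem integral_comp {Ω' : Type*} [MeasurableSpace Ω'] {ν : Measure Ω'} {φ : Ω' → Ω}
    (hf : HasMoments f μ) (hφ : MeasurePreserving φ ν μ) : ∫ x, f (φ x) ∂ν = ∫ x, f x ∂μ := by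
  have h := integral_map hφ.measurable.aemeasurable (f := f)
    (by rw [hφ.map_eq]; exact hf.integrable.aestronglyMeasurable)
  rw [← h, hφ.map_eq]

theorem fst {Ω' : Type*} [MeasurableSpace Ω'] {ν : Measure Ω'} [IsProbabilityMeasure ν]
    (hf : HasMoments f μ) [SFinite μ] : HasMoments (fun x : Ω × Ω' => f x.1) (μ.prod ν) :=
  hf.comp measurePreserving_fst

theorem snd {Ω' : Type*} [MeasurableSpace Ω'] {ν : Measure Ω'} [IsProbabilityMeasure ν]
    (hf : HasMoments f μ) [SFinite μ] : HasMoments (fun x : Ω' × Ω => f x.2) (ν.prod μ) :=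
  hf.comp measurePreserving_snd

end HasMoments

/-! ### Gaussian integration by parts and moments of quadratic forms -/

section Moments

variable {ι : Type*} [Fintype ι]

theorem hasMoments_coord (i : ι) : HasMoments (fun x : ι → ℝ => x i) (stdGauss ι) := by
  have h : HasMoments (id : ℝ → ℝ) (gaussianReal 0 1) := fun p => memLp_id_gaussianReal p
  exact h.comp (measurePreserving_eval (fun _ : ι => gaussianReal 0 1) i)

theorem hasMoments_eval (p : MvPolynomial ι ℝ) :
    HasMoments (fun x => MvPolynomial.eval x p) (stdGauss ι) := by
  induction p using MvPolynomial.induction_on with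
  | C a => simpa using HasMoments.const a
  | add p q hp hq => simpa using hp.add hq
  | mul_X p i hp => simpa using hp.mul (hasMoments_coord i)

/-- The derivative of `φ(x) x^k`, with `φ` the density and `φ' = -xφ`, integrates to zero. At `k =
0` the truncated exponent `k - 1` is harmless, since its coefficient vanishes. -/
theorem integral_pow_succ_gaussianReal (k : ℕ) :
    ∫ x, x ^ (k + 1) ∂gaussianReal 0 1 = k * ∫ x, x ^ (k - 1) ∂gaussianReal 0 1 := by
  have hm : HasMoments (id : ℝ → ℝ) (gaussianReal 0 1) := fun p => memLp_id_gaussianReal p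
  have hint : ∀ j : ℕ, Integrable (fun x : ℝ => gaussianPDFReal 0 1 x * x ^ j) := by
    intro j
    have h := (hm.pow j).integrable
    rw [gaussianReal_of_var_ne_zero 0 one_ne_zero,
      integrable_withDensity_iff_integrable_smul' (measurable_gaussianPDF 0 1)
        (Filter.Eventually.of_forall fun x => gaussianPDF_lt_top)] at h
    simpa [gaussianPDF, gaussianPDFReal_nonneg] using h
  have hd : ∀ x : ℝ, HasDerivAt (gaussianPDFReal 0 1) (-(x * gaussianPDFReal 0 1 x)) x := by
    intro x
    have h1 : HasDerivAt (fun x : ℝ => -(x - 0) ^ 2 / (2 * ((1 : ℝ≥0) : ℝ))) (-x) x := by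
      refine HasDerivAt.congr_deriv (f' := -(2 * x) / 2) ?_ (by ring)
      simpa using ((hasDerivAt_id x).pow 2).neg.div_const 2
    have h2 := (h1.exp).const_mul (√(2 * Real.pi * ((1 : ℝ≥0) : ℝ)))⁻¹
    refine HasDerivAt.congr_deriv h2 ?_
    unfold gaussianPDFReal
    ring
  have h0 := integral_eq_zero_of_hasDerivAt_of_integrable
    (f := fun x : ℝ => gaussianPDFReal 0 1 x * x ^ k)
    (f' := fun x : ℝ => k * (gaussianPDFReal 0 1 x * x ^ (k - 1))
      - gaussianPDFReal 0 1 x * x ^ (k + 1))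
    (fun x => ((hd x).mul (hasDerivAt_pow k x)).congr_deriv (by ring))
    (((hint (k - 1)).const_mul _).sub (hint (k + 1))) (hint k)
  rw [integral_sub ((hint (k - 1)).const_mul _) (hint (k + 1)), integral_const_mul] at h0
  rw [integral_gaussianReal_eq_integral_smul one_ne_zero,
    integral_gaussianReal_eq_integral_smul one_ne_zero]
  simp only [smul_eq_mul]
  linarith

/-- Gaussian integration by parts for polynomials. -/
theorem integral_coord_mul_eval [DecidableEq ι] (i : ι) (p : MvPolynomial ι ℝ) :
    ∫ x, x i * MvPolynomial.eval x p ∂stdGauss ι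
      = ∫ x, MvPolynomial.eval x (MvPolynomial.pderiv i p) ∂stdGauss ι := by
  induction p using MvPolynomial.induction_on' with
  | monomial s a =>
    -- Monomial integrals factor over coordinates, and only the `i`-th factor differs between the
    -- two sides, so the one-dimensional recursion suffices.
    have key : ∀ t : ι →₀ ℕ, ∫ x, ∏ j, x j ^ t j ∂stdGauss ι
        = ∏ j, ∫ x, x ^ t j ∂gaussianReal 0 1 := fun t =>
      integral_fintype_prod_eq_prod (fun j (x : ℝ) => x ^ t j)
    have h1 : ∀ x : ι → ℝ, x i * MvPolynomial.eval x (MvPolynomial.monomial s a)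
        = a * ∏ j, x j ^ (s + Finsupp.single i 1 : ι →₀ ℕ) j := by
      intro x
      rw [MvPolynomial.eval_monomial, Finsupp.prod_fintype _ _ (by simp)]
      simp only [Finsupp.add_apply, pow_add, Finset.prod_mul_distrib]
      have : ∏ j, x j ^ (Finsupp.single i 1 : ι →₀ ℕ) j = x i := by
        rw [Finset.prod_eq_single i] <;> simp +contextual [eq_comm]
      rw [this]; ring
    have h2 : ∀ x : ι → ℝ,
        MvPolynomial.eval x (MvPolynomial.pderiv i (MvPolynomial.monomial s a))
        = a * s i * ∏ j, x j ^ (s - Finsupp.single i 1 : ι →₀ ℕ) j := by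
      intro x
      rw [MvPolynomial.pderiv_monomial, MvPolynomial.eval_monomial,
        Finsupp.prod_fintype _ _ (by simp)]
    simp only [h1, h2]
    rw [integral_const_mul, integral_const_mul, key, key,
      ← Finset.mul_prod_erase _ _ (Finset.mem_univ i),
      ← Finset.mul_prod_erase (a := i) _ (fun j => ∫ x, x ^ (s - Finsupp.single i 1 : ι →₀ ℕ) j
        ∂gaussianReal 0 1) (Finset.mem_univ i)]
    have h3 : ∀ j ∈ Finset.univ.erase i,
        ∫ x : ℝ, x ^ (s + Finsupp.single i 1 : ι →₀ ℕ) j ∂gaussianReal 0 1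
          = ∫ x : ℝ, x ^ (s - Finsupp.single i 1 : ι →₀ ℕ) j ∂gaussianReal 0 1 := by
      intro j hj
      have : i ≠ j := fun h => by simp [h] at hj
      simp [this]
    rw [Finset.prod_congr rfl h3]
    simp only [Finsupp.add_apply, Finsupp.single_eq_same, Finsupp.tsub_apply]
    rw [integral_pow_succ_gaussianReal]
    ring
  | add p q hp hq =>
    simp only [map_add, mul_add]
    rw [integral_add, integral_add, hp, hq]
    · exact (hasMoments_eval _).integrable
    · exact (hasMoments_eval _).integrable
    · exact ((hasMoments_coord i).mul (hasMoments_eval _)).integrable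
    · exact ((hasMoments_coord i).mul (hasMoments_eval _)).integrable

/-- The moments of a Gaussian quadratic form. -/
theorem integral_quadForm_pow_succ {B : Matrix ι ι ℝ} (hB : B.IsSymm) (p : ℕ) :
    ∫ x, (x ⬝ᵥ B *ᵥ x) ^ (p + 1) ∂stdGauss ι
      = B.trace * ∫ x, (x ⬝ᵥ B *ᵥ x) ^ p ∂stdGauss ι
        + 2 * p * ∫ x, (x ⬝ᵥ B *ᵥ x) ^ (p - 1) * (x ⬝ᵥ (B * B) *ᵥ x) ∂stdGauss ι := by
  classical
  let l : ι → MvPolynomial ι ℝ := fun i => ∑ j, MvPolynomial.C (B i j) * MvPolynomial.X j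
  let q : MvPolynomial ι ℝ := ∑ i, MvPolynomial.X i * l i
  have el : ∀ x i, MvPolynomial.eval x (l i) = (B *ᵥ x) i := by
    intro x i; simp [l, Matrix.mulVec, dotProduct]
  have eq : ∀ x, MvPolynomial.eval x q = x ⬝ᵥ B *ᵥ x := by
    intro x; simp [q, el, dotProduct]
  have dl : ∀ i k, MvPolynomial.pderiv k (l i) = MvPolynomial.C (B i k) := by
    intro i k
    simp only [l, map_sum, Derivation.leibniz, MvPolynomial.pderiv_C,
      MvPolynomial.pderiv_X, smul_eq_mul]
    rw [Finset.sum_eq_single k] <;> simp +contextual [eq_comm]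
  have dq : ∀ k, MvPolynomial.pderiv k q = 2 * l k := by
    intro k
    simp only [q, map_sum, Derivation.leibniz, dl, MvPolynomial.pderiv_X, smul_eq_mul,
      Finset.sum_add_distrib]
    have h1 : ∑ i, MvPolynomial.X i * MvPolynomial.C (B i k) = l k := by
      refine Finset.sum_congr rfl fun i _ => ?_
      rw [hB.apply k i, mul_comm]
    have h2 : ∑ i, l i * (Pi.single k (1 : MvPolynomial ι ℝ) : ι → MvPolynomial ι ℝ) i = l k := by
      rw [Finset.sum_eq_single k] <;> simp +contextual [eq_comm]
    rw [h1, h2]; ring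
  have hM : ∀ r : MvPolynomial ι ℝ, Integrable (fun x => MvPolynomial.eval x r) (stdGauss ι) :=
    fun r => (hasMoments_eval r).integrable
  have sq : ∀ x : ι → ℝ, ∑ i, (B *ᵥ x) i * (B *ᵥ x) i = x ⬝ᵥ (B * B) *ᵥ x := by
    intro x
    rw [← Matrix.mulVec_mulVec, Matrix.dotProduct_mulVec, ← Matrix.mulVec_transpose, hB.eq]
    rfl
  -- Write the form as `∑ xᵢ (Bx)ᵢ` and integrate by parts in each `xᵢ`: differentiating `(Bx)ᵢ`
  -- yields the trace, and differentiating `q^p` yields `2p q^(p-1) (Bx)ᵢ`, hence `B²`.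
  calc ∫ x, (x ⬝ᵥ B *ᵥ x) ^ (p + 1) ∂stdGauss ι
      = ∫ x, ∑ i, x i * MvPolynomial.eval x (l i * q ^ p) ∂stdGauss ι := by
        congr 1; ext x
        simp only [map_mul, map_pow, el, eq, ← mul_assoc, ← Finset.sum_mul]
        rw [pow_succ, mul_comm]; rfl
    _ = ∑ i, ∫ x, MvPolynomial.eval x (MvPolynomial.pderiv i (l i * q ^ p)) ∂stdGauss ι := by
        rw [integral_finsetSum]
        · simp only [integral_coord_mul_eval]
        · intro i _
          exact ((hasMoments_coord i).mul (hasMoments_eval _)).integrable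
    _ = ∫ x, B.trace * (x ⬝ᵥ B *ᵥ x) ^ p
          + 2 * p * ((x ⬝ᵥ B *ᵥ x) ^ (p - 1) * (x ⬝ᵥ (B * B) *ᵥ x)) ∂stdGauss ι := by
        rw [← integral_finsetSum _ fun i _ => hM _]
        congr 1; ext x
        simp only [Derivation.leibniz, Derivation.leibniz_pow, dl, dq, smul_eq_mul, map_add,
          map_mul, map_pow, el, eq, MvPolynomial.eval_C, nsmul_eq_mul, map_natCast, map_ofNat,
          Finset.sum_add_distrib, ← sq, Matrix.trace, Matrix.diag, Finset.mul_sum, Finset.sum_mul]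
        rw [add_comm]
        congr 1
        · exact Finset.sum_congr rfl fun i _ => by ring
        · exact Finset.sum_congr rfl fun i _ => by ring
    _ = _ := by
        rw [integral_add, integral_const_mul, integral_const_mul]
        · have := hM (MvPolynomial.C B.trace * q ^ p)
          simpa [eq] using this
        · have := hM (MvPolynomial.C (2 * (p : ℝ)) * (q ^ (p - 1) * ∑ i, l i * l i))
          simpa [eq, el, sq] using this

end Moments

/-! ### Upper and lower bounds for moments of quadratic forms -/

section QuadForm

variable {ι : Type*} [Fintype ι]

theorem dotProduct_self_nonneg_real (v : ι → ℝ) : 0 ≤ v ⬝ᵥ v :=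
  Finset.sum_nonneg fun i _ => mul_self_nonneg (v i)

theorem hasMoments_dotProduct (a : ι → ℝ) : HasMoments (fun x => a ⬝ᵥ x) (stdGauss ι) :=
  HasMoments.sum _ fun i => (hasMoments_coord i).const_mul (a i)

theorem hasMoments_quadForm (B : Matrix ι ι ℝ) :
    HasMoments (fun x => x ⬝ᵥ B *ᵥ x) (stdGauss ι) :=
  HasMoments.sum _ fun i => (hasMoments_coord i).mul (hasMoments_dotProduct (B i))

theorem integral_quadForm (B : Matrix ι ι ℝ) :
    ∫ x, x ⬝ᵥ B *ᵥ x ∂stdGauss ι = B.trace := by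
  have hs : (B + Bᵀ).IsSymm := by simp [Matrix.IsSymm, add_comm]
  have h := integral_quadForm_pow_succ hs 0
  have e : ∀ x : ι → ℝ, x ⬝ᵥ (B + Bᵀ) *ᵥ x = 2 * (x ⬝ᵥ B *ᵥ x) := by
    intro x
    rw [Matrix.add_mulVec, dotProduct_add, Matrix.mulVec_transpose, Matrix.dotProduct_mulVec x B x,
      dotProduct_comm x (x ᵥ* B)]
    ring
  simp only [e, zero_add, pow_one, pow_zero, integral_const_mul, Matrix.trace_add,
    Matrix.trace_transpose] at h
  simp at h
  linarith

theorem integral_quadForm_sq {B : Matrix ι ι ℝ} (hB : B.IsSymm) :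
    ∫ x, (x ⬝ᵥ B *ᵥ x) ^ 2 ∂stdGauss ι = B.trace ^ 2 + 2 * (B * B).trace := by
  have := integral_quadForm_pow_succ hB 1
  simp only [pow_one, integral_quadForm, Nat.sub_self, pow_zero, one_mul] at this
  rw [this]; push_cast; ring

/-- Since `B² ≤ bB`, each step of the moment recursion costs at most a factor `tr B + 2pb`. Bounding
it by the fixed `t + 2mb` makes the induction multiply equal factors. -/
theorem integral_quadForm_pow_le {B : Matrix ι ι ℝ} (hB : B.IsSymm)
    (h0 : ∀ x, 0 ≤ x ⬝ᵥ B *ᵥ x) {t b : ℝ} (ht : B.trace ≤ t) (hb0 : 0 ≤ b)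
    (hb : ∀ x, x ⬝ᵥ (B * B) *ᵥ x ≤ b * (x ⬝ᵥ B *ᵥ x)) {p m : ℕ} (hp : p ≤ m) :
    ∫ x, (x ⬝ᵥ B *ᵥ x) ^ p ∂stdGauss ι ≤ (t + 2 * m * b) ^ p := by
  have hM := hasMoments_quadForm B
  have ht0 : 0 ≤ B.trace := by
    rw [← integral_quadForm B]; exact integral_nonneg h0
  have hc : 0 ≤ t + 2 * m * b := by
    have : 0 ≤ 2 * m * b := by positivity
    linarith
  induction p with
  | zero => simp
  | succ p ih =>
    have ih := ih (Nat.le_of_succ_le hp)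
    rw [integral_quadForm_pow_succ hB]
    have hI : 0 ≤ ∫ x, (x ⬝ᵥ B *ᵥ x) ^ p ∂stdGauss ι := integral_nonneg fun x => pow_nonneg (h0 x) p
    have hs : p * ∫ x, (x ⬝ᵥ B *ᵥ x) ^ (p - 1) * (x ⬝ᵥ (B * B) *ᵥ x) ∂stdGauss ι
        ≤ p * (b * ∫ x, (x ⬝ᵥ B *ᵥ x) ^ p ∂stdGauss ι) := by
      rcases p with _ | p
      · simp
      · gcongr
        rw [← integral_const_mul]
        refine integral_mono ((hM.pow _).mul (hasMoments_quadForm _)).integrable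
          ((hM.pow _).const_mul b).integrable fun x => ?_
        have := mul_le_mul_of_nonneg_left (hb x) (pow_nonneg (h0 x) p)
        simp only [Nat.add_sub_cancel]
        calc _ ≤ _ := this
          _ = _ := by ring
    have hpm : (p : ℝ) ≤ m := by exact_mod_cast Nat.le_of_succ_le hp
    calc _ ≤ t * ∫ x, (x ⬝ᵥ B *ᵥ x) ^ p ∂stdGauss ι
          + 2 * (m * (b * ∫ x, (x ⬝ᵥ B *ᵥ x) ^ p ∂stdGauss ι)) := by
            rw [mul_assoc 2]
            have := mul_le_mul_of_nonneg_right ht hI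
            have := mul_le_mul_of_nonneg_right hpm (mul_nonneg hb0 hI)
            linarith
      _ = (t + 2 * m * b) * ∫ x, (x ⬝ᵥ B *ᵥ x) ^ p ∂stdGauss ι := by ring
      _ ≤ (t + 2 * m * b) * (t + 2 * m * b) ^ p := by gcongr
      _ = _ := by ring

theorem dotProduct_vecMulVec_mulVec (a x : ι → ℝ) :
    x ⬝ᵥ Matrix.vecMulVec a a *ᵥ x = (a ⬝ᵥ x) ^ 2 := by
  simp [Matrix.vecMulVec_mulVec, dotProduct_smul, dotProduct_comm x a, sq]

theorem isSymm_vecMulVec {ι : Type*} (a : ι → ℝ) : (Matrix.vecMulVec a a).IsSymm := by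
  simp [Matrix.IsSymm, Matrix.transpose_vecMulVec]

/-- For `B = aaᵀ` one has `B² = ‖a‖² B`, so the recursion closes with factor `(2p + 1)‖a‖²`, which
is at least `(p + 1)‖a‖²`. -/
theorem factorial_mul_le_integral_dotProduct_pow (a : ι → ℝ) (p : ℕ) :
    p.factorial * (a ⬝ᵥ a) ^ p ≤ ∫ x, ((a ⬝ᵥ x) ^ 2) ^ p ∂stdGauss ι := by
  have ha : 0 ≤ a ⬝ᵥ a := dotProduct_self_nonneg_real a
  simp_rw [← dotProduct_vecMulVec_mulVec]
  induction p with
  | zero => simp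
  | succ p ih =>
    have hI : 0 ≤ ∫ x, (x ⬝ᵥ Matrix.vecMulVec a a *ᵥ x) ^ p ∂stdGauss ι :=
      integral_nonneg fun x => by simp only [dotProduct_vecMulVec_mulVec]; positivity
    rw [integral_quadForm_pow_succ (isSymm_vecMulVec a), Matrix.trace_vecMulVec]
    have h2 : p * ∫ x, (x ⬝ᵥ Matrix.vecMulVec a a *ᵥ x) ^ (p - 1)
        * (x ⬝ᵥ (Matrix.vecMulVec a a * Matrix.vecMulVec a a) *ᵥ x) ∂stdGauss ι
        = p * ((a ⬝ᵥ a) * ∫ x, (x ⬝ᵥ Matrix.vecMulVec a a *ᵥ x) ^ p ∂stdGauss ι) := by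
      rcases p with _ | p
      · simp
      · congr 1
        rw [← integral_const_mul]
        refine integral_congr_ae (Filter.Eventually.of_forall fun x => ?_)
        dsimp only
        rw [Matrix.vecMulVec_mul_vecMulVec, Matrix.vecMulVec_smul, Matrix.smul_mulVec,
          dotProduct_smul]
        simp only [Nat.add_sub_cancel, smul_eq_mul]
        ring
    rw [mul_assoc 2, h2, Nat.factorial_succ, pow_succ]
    push_cast
    have := mul_le_mul_of_nonneg_left ih ha
    have h3 := mul_nonneg ha hI
    have : (0 : ℝ) ≤ p := by positivity
    nlinarith

end QuadForm

/-! ### Cauchy–Schwarz for positive semidefinite matrices -/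

section Nonneg

variable {ι : Type*} [Fintype ι] {N : Matrix ι ι ℝ}

theorem Matrix.IsSymm.dotProduct_mulVec_comm (hN : N.IsSymm) (v w : ι → ℝ) :
    v ⬝ᵥ N *ᵥ w = w ⬝ᵥ N *ᵥ v := by
  rw [Matrix.dotProduct_mulVec, ← Matrix.mulVec_transpose, hN.eq, dotProduct_comm]

theorem Matrix.IsSymm.dotProduct_mulVec_mulVec (hN : N.IsSymm) (v : ι → ℝ) :
    v ⬝ᵥ (N * N) *ᵥ v = (N *ᵥ v) ⬝ᵥ (N *ᵥ v) := by
  rw [← Matrix.mulVec_mulVec, Matrix.dotProduct_mulVec, ← Matrix.mulVec_transpose, hN.eq]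

theorem Matrix.IsSymm.sq_dotProduct_mulVec_le (hN : N.IsSymm) (h0 : ∀ x, 0 ≤ x ⬝ᵥ N *ᵥ x)
    (v w : ι → ℝ) : (v ⬝ᵥ N *ᵥ w) ^ 2 ≤ (v ⬝ᵥ N *ᵥ v) * (w ⬝ᵥ N *ᵥ w) := by
  have h : ∀ t : ℝ, 0 ≤ (w ⬝ᵥ N *ᵥ w) * (t * t) + 2 * (v ⬝ᵥ N *ᵥ w) * t + v ⬝ᵥ N *ᵥ v := by
    intro t
    have := h0 (v + t • w)
    simp only [Matrix.mulVec_add, Matrix.mulVec_smul, dotProduct_add, add_dotProduct,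
      smul_dotProduct, dotProduct_smul, smul_eq_mul, hN.dotProduct_mulVec_comm w v] at this
    linarith
  have := discrim_le_zero h
  rw [discrim] at this
  linarith

/-- This is `N² ≤ sN` from `0 ≤ N ≤ s`: Cauchy–Schwarz for the form of `N`, applied to `v` and `Nv`,
gives `‖Nv‖⁴ ≤ (vᵀNv) · s‖Nv‖²`. -/
theorem Matrix.IsSymm.mulVec_dotProduct_mulVec_le (hN : N.IsSymm) (h0 : ∀ x, 0 ≤ x ⬝ᵥ N *ᵥ x)
    {s : ℝ} (hs0 : 0 ≤ s) (hs : ∀ v, v ⬝ᵥ N *ᵥ v ≤ s * (v ⬝ᵥ v)) (v : ι → ℝ) :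
    (N *ᵥ v) ⬝ᵥ (N *ᵥ v) ≤ s * (v ⬝ᵥ N *ᵥ v) := by
  have h1 := hN.sq_dotProduct_mulVec_le h0 v (N *ᵥ v)
  have h2 : v ⬝ᵥ N *ᵥ (N *ᵥ v) = (N *ᵥ v) ⬝ᵥ (N *ᵥ v) := by
    rw [Matrix.mulVec_mulVec, hN.dotProduct_mulVec_mulVec]
  rw [h2] at h1
  have h4 := mul_le_mul_of_nonneg_left (hs (N *ᵥ v)) (h0 v)
  rcases (dotProduct_self_nonneg_real (N *ᵥ v)).eq_or_lt with h | h
  · rw [← h]; exact mul_nonneg hs0 (h0 v)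
  · refine le_of_mul_le_mul_right ?_ h
    calc _ = ((N *ᵥ v) ⬝ᵥ (N *ᵥ v)) ^ 2 := by ring
      _ ≤ _ := h1.trans h4
      _ = _ := by ring

theorem sq_dotProduct_le (v w : ι → ℝ) : (v ⬝ᵥ w) ^ 2 ≤ (v ⬝ᵥ v) * (w ⬝ᵥ w) := by
  simpa [dotProduct, sq] using Finset.sum_mul_sq_le_sq_mul_sq Finset.univ v w

end Nonneg

/-! ### Spectral norm against Gaussian moments -/

section SpecNorm

variable {m : ℕ}

theorem specNorm_nonneg (M : Matrix (Fin m) (Fin m) ℝ) : 0 ≤ specNorm M := norm_nonneg _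

theorem norm_toLp_sq (v : Fin m → ℝ) : ‖WithLp.toLp 2 v‖ ^ 2 = v ⬝ᵥ v := by
  rw [EuclideanSpace.real_norm_sq_eq]; simp [dotProduct, sq]

theorem mulVec_dotProduct_mulVec_le (M : Matrix (Fin m) (Fin m) ℝ) (v : Fin m → ℝ) :
    (M *ᵥ v) ⬝ᵥ (M *ᵥ v) ≤ specNorm M ^ 2 * (v ⬝ᵥ v) := by
  have := (Matrix.toEuclideanCLM (n := Fin m) (𝕜 := ℝ) M).le_opNorm (WithLp.toLp 2 v)
  rw [Matrix.toEuclideanCLM_toLp] at this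
  rw [← norm_toLp_sq, ← norm_toLp_sq, ← mul_pow]
  exact pow_le_pow_left₀ (norm_nonneg _) this 2

theorem specNorm_le {M : Matrix (Fin m) (Fin m) ℝ} {c : ℝ} (hc : 0 ≤ c)
    (h : ∀ v, (M *ᵥ v) ⬝ᵥ (M *ᵥ v) ≤ c ^ 2 * (v ⬝ᵥ v)) : specNorm M ≤ c := by
  refine ContinuousLinearMap.opNorm_le_bound _ hc fun x => ?_
  have := h x.ofLp
  rw [← norm_toLp_sq, ← norm_toLp_sq, ← mul_pow, ← Matrix.toEuclideanCLM_toLp] at this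
  exact le_of_pow_le_pow_left₀ two_ne_zero (by positivity) this

theorem dotProduct_mulVec_le (M : Matrix (Fin m) (Fin m) ℝ) (v : Fin m → ℝ) :
    v ⬝ᵥ M *ᵥ v ≤ specNorm M * (v ⬝ᵥ v) := by
  have h0 : 0 ≤ v ⬝ᵥ v := dotProduct_self_nonneg_real v
  refine le_of_pow_le_pow_left₀ two_ne_zero (mul_nonneg (specNorm_nonneg M) h0) ?_
  calc _ ≤ (v ⬝ᵥ v) * ((M *ᵥ v) ⬝ᵥ (M *ᵥ v)) := sq_dotProduct_le _ _
    _ ≤ (v ⬝ᵥ v) * (specNorm M ^ 2 * (v ⬝ᵥ v)) := by gcongr; exact mulVec_dotProduct_mulVec_le M v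
    _ = _ := by ring

theorem mulVec_dotProduct_mulVec_le_of_nonneg {M : Matrix (Fin m) (Fin m) ℝ} (hM : M.IsSymm)
    (h0 : ∀ x, 0 ≤ x ⬝ᵥ M *ᵥ x) (v : Fin m → ℝ) :
    (M *ᵥ v) ⬝ᵥ (M *ᵥ v) ≤ specNorm M * (v ⬝ᵥ M *ᵥ v) :=
  hM.mulVec_dotProduct_mulVec_le h0 (specNorm_nonneg M) (dotProduct_mulVec_le M) v

/-- The spectral norm is controlled by the moments of the quadratic form at a Gaussian vector. -/
theorem specNorm_pow_mul_factorial_le {N : Matrix (Fin m) (Fin m) ℝ} (hN : N.IsSymm)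
    (h0 : ∀ x, 0 ≤ x ⬝ᵥ N *ᵥ x) {p : ℕ} (hp : p ≠ 0) :
    specNorm N ^ p * p.factorial ≤ ∫ u, (u ⬝ᵥ N *ᵥ u) ^ p ∂stdGauss (Fin m) := by
  set I := ∫ u, (u ⬝ᵥ N *ᵥ u) ^ p ∂stdGauss (Fin m) with hI
  have hI0 : 0 ≤ I := integral_nonneg fun u => pow_nonneg (h0 u) p
  have hf : (0 : ℝ) < p.factorial := by exact_mod_cast p.factorial_pos
  have hq : 0 ≤ I / p.factorial := by positivity
  set c := (I / p.factorial) ^ ((p : ℝ)⁻¹) with hc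
  have hcp : c ^ p = I / p.factorial := Real.rpow_inv_natCast_pow hq hp
  have hc0 : 0 ≤ c := Real.rpow_nonneg hq _
  suffices specNorm N ≤ c by
    rw [← le_div_iff₀ hf, ← hcp]
    exact pow_le_pow_left₀ (specNorm_nonneg N) this p
  refine specNorm_le hc0 fun w => ?_
  set a := N *ᵥ w with ha
  have ha0 : 0 ≤ a ⬝ᵥ a := dotProduct_self_nonneg_real a
  have hw0 : 0 ≤ w ⬝ᵥ w := dotProduct_self_nonneg_real w
  rcases ha0.eq_or_lt with h | hpos
  · rw [← h]; positivity
  -- Cauchy–Schwarz for the form of `N` gives `(a·u)² ≤ (w·a)(uᵀNu)` with `a = Nw`; take `p`-th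
  -- powers and average over `u`.
  have h1 : p.factorial * (a ⬝ᵥ a) ^ p ≤ (w ⬝ᵥ a) ^ p * I := by
    refine (factorial_mul_le_integral_dotProduct_pow a p).trans ?_
    rw [hI, ← integral_const_mul]
    refine integral_mono (((hasMoments_dotProduct a).pow 2).pow p).integrable
      (((hasMoments_quadForm N).pow p).const_mul _).integrable fun u => ?_
    simp only [← mul_pow]
    refine pow_le_pow_left₀ (sq_nonneg _) ?_ p
    have := hN.sq_dotProduct_mulVec_le h0 w u
    rwa [hN.dotProduct_mulVec_comm w u, dotProduct_comm] at this
  -- Squaring makes `(w·a)² ≤ ‖w‖²‖a‖²` applicable; a factor `(a ⬝ᵥ a) ^ p` then cancels.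
  have h2 : (p.factorial * (a ⬝ᵥ a) ^ p) ^ 2 ≤ ((w ⬝ᵥ w) * (a ⬝ᵥ a)) ^ p * I ^ 2 := by
    calc _ ≤ ((w ⬝ᵥ a) ^ p * I) ^ 2 := pow_le_pow_left₀ (by positivity) h1 2
      _ = ((w ⬝ᵥ a) ^ 2) ^ p * I ^ 2 := by ring
      _ ≤ _ := by gcongr; exact sq_dotProduct_le w a
  refine le_of_pow_le_pow_left₀ hp (by positivity) ?_
  rw [mul_pow, ← pow_mul, mul_comm 2 p, pow_mul, hcp, div_pow, div_mul_eq_mul_div,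
    le_div_iff₀ (by positivity)]
  refine le_of_mul_le_mul_right ?_ (pow_pos hpos p)
  calc _ = (p.factorial * (a ⬝ᵥ a) ^ p) ^ 2 := by ring
    _ ≤ _ := h2
    _ = _ := by rw [mul_pow]; ring

end SpecNorm

/-! ### Characteristic functions and invariances of the Gaussian law -/

section Law

variable {ι κ ν : Type*} [Fintype ι] [Fintype κ] [Fintype ν]

theorem integral_cexp_dotProduct (t : ι → ℝ) :
    ∫ x : ι → ℝ, Complex.exp ((x ⬝ᵥ t : ℝ) * Complex.I) ∂stdGauss ι
      = Complex.exp ((-(t ⬝ᵥ t) / 2 : ℝ)) := by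
  have h := charFun_stdGaussian (E := EuclideanSpace ℝ ι) (WithLp.toLp 2 t)
  rw [← map_pi_eq_stdGaussian, charFun_apply, integral_map (by fun_prop) (by fun_prop)] at h
  have h2 : ‖WithLp.toLp 2 t‖ ^ 2 = t ⬝ᵥ t := by
    rw [EuclideanSpace.real_norm_sq_eq]; simp [dotProduct, sq]
  have h1 : ∀ x : ι → ℝ, inner ℝ (WithLp.toLp 2 x) (WithLp.toLp 2 t) = x ⬝ᵥ t := by
    intro x; simp [PiLp.inner_apply, dotProduct, mul_comm]
  simp only [h1] at h
  rw [h, ← h2]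
  push_cast
  rfl

theorem measure_ext_of_integral_cexp_dotProduct {μ μ' : Measure (ι → ℝ)} [IsFiniteMeasure μ]
    [IsFiniteMeasure μ']
    (h : ∀ t : ι → ℝ, ∫ x : ι → ℝ, Complex.exp ((x ⬝ᵥ t : ℝ) * Complex.I) ∂μ
      = ∫ x : ι → ℝ, Complex.exp ((x ⬝ᵥ t : ℝ) * Complex.I) ∂μ') : μ = μ' := by
  have e : μ.map (WithLp.toLp 2) = μ'.map (WithLp.toLp 2) := by
    apply Measure.ext_of_charFun
    ext t
    rw [charFun_apply, charFun_apply, integral_map (by fun_prop) (by fun_prop),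
      integral_map (by fun_prop) (by fun_prop)]
    simpa [PiLp.inner_apply, dotProduct, mul_comm] using h t.ofLp
  have := congrArg (Measure.map (WithLp.ofLp (p := 2) (V := ι → ℝ))) e
  rw [Measure.map_map (by fun_prop) (by fun_prop), Measure.map_map (by fun_prop) (by fun_prop)]
    at this
  simpa [Function.comp_def] using this

/-- A linear image of two independent standard Gaussian vectors, with identity covariance, is a
standard Gaussian vector. -/
theorem measurePreserving_mulVec_add_mulVec [DecidableEq ν] {L : Matrix ν ι ℝ} {M : Matrix ν κ ℝ}
    (h : L * Lᵀ + M * Mᵀ = 1) :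
    MeasurePreserving (fun z : (ι → ℝ) × (κ → ℝ) => L *ᵥ z.1 + M *ᵥ z.2)
      ((stdGauss ι).prod (stdGauss κ)) (stdGauss ν) := by
  have hm : Measurable (fun z : (ι → ℝ) × (κ → ℝ) => L *ᵥ z.1 + M *ᵥ z.2) := by
    refine Continuous.measurable ?_
    fun_prop
  refine ⟨hm, ?_⟩
  have : IsProbabilityMeasure (Measure.map (fun z : (ι → ℝ) × (κ → ℝ) => L *ᵥ z.1 + M *ᵥ z.2)
      ((stdGauss ι).prod (stdGauss κ))) := Measure.isProbabilityMeasure_map hm.aemeasurable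
  refine measure_ext_of_integral_cexp_dotProduct fun t => ?_
  rw [integral_map hm.aemeasurable
    (Continuous.aestronglyMeasurable (by unfold dotProduct; fun_prop)), integral_cexp_dotProduct]
  have e : ∀ z : (ι → ℝ) × (κ → ℝ),
      Complex.exp (((L *ᵥ z.1 + M *ᵥ z.2) ⬝ᵥ t : ℝ) * Complex.I)
        = Complex.exp ((z.1 ⬝ᵥ (Lᵀ *ᵥ t) : ℝ) * Complex.I)
          * Complex.exp ((z.2 ⬝ᵥ (Mᵀ *ᵥ t) : ℝ) * Complex.I) := by
    intro z
    rw [← Complex.exp_add, ← add_mul, ← Complex.ofReal_add, add_dotProduct,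
      Matrix.mulVec_transpose, Matrix.mulVec_transpose]
    simp only [dotProduct_comm _ t, Matrix.dotProduct_mulVec, dotProduct_comm _ (t ᵥ* _)]
  simp only [e]
  rw [integral_prod_mul (fun x : ι → ℝ => Complex.exp ((x ⬝ᵥ (Lᵀ *ᵥ t) : ℝ) * Complex.I))
    (fun x : κ → ℝ => Complex.exp ((x ⬝ᵥ (Mᵀ *ᵥ t) : ℝ) * Complex.I)),
    integral_cexp_dotProduct, integral_cexp_dotProduct, ← Complex.exp_add, ← Complex.ofReal_add]
  have : (Lᵀ *ᵥ t) ⬝ᵥ (Lᵀ *ᵥ t) + (Mᵀ *ᵥ t) ⬝ᵥ (Mᵀ *ᵥ t) = t ⬝ᵥ t := by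
    have h' := congrArg (fun N => t ⬝ᵥ N *ᵥ t) h
    simp only [Matrix.add_mulVec, dotProduct_add, Matrix.one_mulVec,
      ← Matrix.mulVec_mulVec] at h'
    rw [Matrix.dotProduct_mulVec t L, Matrix.dotProduct_mulVec t M] at h'
    rw [← h', Matrix.mulVec_transpose, Matrix.mulVec_transpose]
  rw [← this]
  congr 2
  ring

instance isGaussian_stdGauss : IsGaussian (stdGauss ι) := by
  have h := map_pi_eq_stdGaussian (ι := ι)
  have h2 : stdGauss ι
      = (stdGaussian (EuclideanSpace ℝ ι)).map (EuclideanSpace.equiv ι ℝ : _ →L[ℝ] (ι → ℝ)) := by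
    rw [← h, Measure.map_map (by fun_prop) (by fun_prop)]
    have : (⇑(EuclideanSpace.equiv ι ℝ : EuclideanSpace ℝ ι →L[ℝ] (ι → ℝ)) ∘ WithLp.toLp 2) = id := by
      ext x; rfl
    rw [this, Measure.map_id]
  rw [h2]
  infer_instance

theorem integral_coord (i : ι) : ∫ x, x i ∂stdGauss ι = 0 := by
  classical
  simpa using integral_coord_mul_eval i (1 : MvPolynomial ι ℝ)

theorem integral_stdGauss_id : (stdGauss ι)[id] = 0 := by
  ext i
  have h := (ContinuousLinearMap.proj (R := ℝ) (φ := fun _ : ι => ℝ) i).integral_comp_comm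
    (IsGaussian.integrable_id (μ := stdGauss ι))
  simp only [ContinuousLinearMap.proj_apply, id] at h
  simpa using h.symm.trans (integral_coord i)

/-- Two independent standard Gaussian vectors `x`, `x'` may be replaced by `(x + x') / √2` and
`(x' - x) / √2`. -/
theorem measurePreserving_rotation :
    MeasurePreserving
      (fun z : (ι → ℝ) × (ι → ℝ) => ((√2 / 2) • (z.1 + z.2), (√2 / 2) • (z.2 - z.1)))
      ((stdGauss ι).prod (stdGauss ι)) ((stdGauss ι).prod (stdGauss ι)) := by
  have h := IsGaussian.map_rotation_eq_self (integral_stdGauss_id (ι := ι)) (Real.pi / 4)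
  have e : (fun z : (ι → ℝ) × (ι → ℝ) => ((√2 / 2) • (z.1 + z.2), (√2 / 2) • (z.2 - z.1)))
      = ContinuousLinearMap.rotation (Real.pi / 4) := by
    ext z <;> simp [ContinuousLinearMap.rotation_apply] <;> ring
  rw [e]
  exact ⟨ContinuousLinearMap.continuous _ |>.measurable, h⟩

end Law

/-! ### Quadratic forms of Kronecker products -/

section Kronecker

open scoped Kronecker

variable {m n : Type*} [Fintype m] [Fintype n]

/-- The matrix with the entries of `x`. -/
def toMat {m n : Type*} (x : m × n → ℝ) : Matrix m n ℝ := Matrix.of fun j k => x (j, k)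

theorem kronecker_mulVec_apply (U : Matrix m m ℝ) (M : Matrix n n ℝ) (x : m × n → ℝ) (j : m)
    (k : n) : ((U ⊗ₖ M) *ᵥ x) (j, k) = (U *ᵥ fun j' => (M *ᵥ toMat x j') k) j := by
  simp only [Matrix.mulVec, dotProduct, Fintype.sum_prod_type, Matrix.kroneckerMap_apply, toMat,
    Matrix.of_apply, Finset.mul_sum, mul_assoc]

theorem dotProduct_kronecker_mulVec (U : Matrix m m ℝ) (M : Matrix n n ℝ) (x : m × n → ℝ) :
    x ⬝ᵥ (U ⊗ₖ M) *ᵥ x = ∑ j, ∑ j', U j j' * (toMat x j ⬝ᵥ M *ᵥ toMat x j') := by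
  rw [dotProduct, Fintype.sum_prod_type]
  refine Finset.sum_congr rfl fun j _ => ?_
  simp only [kronecker_mulVec_apply]
  simp only [Matrix.mulVec, dotProduct, Finset.mul_sum]
  rw [Finset.sum_comm]
  refine Finset.sum_congr rfl fun j' _ => Finset.sum_congr rfl fun k _ =>
    Finset.sum_congr rfl fun k' _ => ?_
  simp only [toMat, Matrix.of_apply]
  ring

theorem dotProduct_one_kronecker_mulVec [DecidableEq m] (M : Matrix n n ℝ) (x : m × n → ℝ) :
    x ⬝ᵥ ((1 : Matrix m m ℝ) ⊗ₖ M) *ᵥ x = ∑ j, toMat x j ⬝ᵥ M *ᵥ toMat x j := by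
  rw [dotProduct_kronecker_mulVec]
  refine Finset.sum_congr rfl fun j _ => ?_
  simp [Matrix.one_apply]

theorem dotProduct_vecMulVec_kronecker_mulVec (u : m → ℝ) (M : Matrix n n ℝ) (x : m × n → ℝ) :
    x ⬝ᵥ (Matrix.vecMulVec u u ⊗ₖ M) *ᵥ x
      = ((toMat x)ᵀ *ᵥ u) ⬝ᵥ M *ᵥ ((toMat x)ᵀ *ᵥ u) := by
  have h : (toMat x)ᵀ *ᵥ u = ∑ j, u j • toMat x j := by
    ext k; simp [Matrix.mulVec, dotProduct, mul_comm]
  rw [dotProduct_kronecker_mulVec, h, Matrix.mulVec_sum, sum_dotProduct]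
  refine Finset.sum_congr rfl fun j _ => ?_
  rw [dotProduct_sum]
  refine Finset.sum_congr rfl fun j' _ => ?_
  rw [Matrix.mulVec_smul, smul_dotProduct, dotProduct_smul, Matrix.vecMulVec_apply]
  simp only [smul_eq_mul]; ring

theorem isSymm_kronecker {m n : Type*} {U : Matrix m m ℝ} {M : Matrix n n ℝ} (hU : U.IsSymm)
    (hM : M.IsSymm) : (U ⊗ₖ M).IsSymm := by
  rw [Matrix.IsSymm, ← Matrix.kroneckerMap_transpose, hU.eq, hM.eq]

end Kronecker

/-! ### Decoupling of Gaussian chaos -/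

section Decoupling

/-- The tangent line of the convex function `t^p` at `s`; it plays the role of Jensen's inequality
below. -/
theorem pow_add_mul_sub_le_pow {s t : ℝ} (hs : 0 ≤ s) (ht : 0 ≤ t) (p : ℕ) :
    s ^ p + p * s ^ (p - 1) * (t - s) ≤ t ^ p := by
  induction p with
  | zero => simp
  | succ p ih =>
    have h := mul_le_mul_of_nonneg_left ih ht
    rw [pow_succ' t]
    refine le_trans ?_ h
    rcases p with _ | p
    · simp
    · have : 0 ≤ (p + 1 : ℝ) * s ^ p * (t - s) ^ 2 := by positivity
      simp only [Nat.add_sub_cancel]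
      push_cast
      linear_combination this

variable {ι κ : Type*} [Fintype ι] [Fintype κ]

theorem HasMoments.bilin {κ : Type*} {Ω : Type*} [MeasurableSpace Ω] {μ : Measure Ω}
    (b : (ι → ℝ) →ₗ[ℝ] (ι → ℝ) →ₗ[ℝ] (κ → ℝ)) {f g : Ω → ι → ℝ}
    (hf : ∀ i, HasMoments (fun ω => f ω i) μ) (hg : ∀ i, HasMoments (fun ω => g ω i) μ) (k : κ) :
    HasMoments (fun ω => b (f ω) (g ω) k) μ := by
  classical
  have e : ∀ x y, b x y k = ∑ i, ∑ j, b (Pi.single i 1) (Pi.single j 1) k * (x i * y j) := by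
    intro x y
    conv_lhs => rw [pi_eq_sum_univ' x, pi_eq_sum_univ' y]
    simp only [map_sum, map_smul, LinearMap.sum_apply, LinearMap.smul_apply, Finset.sum_apply,
      Pi.smul_apply, smul_eq_mul, Finset.mul_sum]
    rw [Finset.sum_comm]
    refine Finset.sum_congr rfl fun i _ => Finset.sum_congr rfl fun j _ => ?_
    ring
  refine (congrArg (HasMoments · μ) (funext fun ω => e (f ω) (g ω))).mpr ?_
  exact HasMoments.sum _ fun i => HasMoments.sum _ fun j => ((hf i).mul (hg j)).const_mul _

theorem HasMoments.dotProduct {Ω : Type*} [MeasurableSpace Ω] {μ : Measure Ω}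
    {f g : Ω → ι → ℝ} (hf : ∀ i, HasMoments (fun ω => f ω i) μ)
    (hg : ∀ i, HasMoments (fun ω => g ω i) μ) : HasMoments (fun ω => f ω ⬝ᵥ g ω) μ :=
  HasMoments.sum _ fun i => (hf i).mul (hg i)

/-- Decoupling of a centered Gaussian chaos of order two with values in a Euclidean space. -/
theorem integral_bilin_self_pow_le (b : (ι → ℝ) →ₗ[ℝ] (ι → ℝ) →ₗ[ℝ] (κ → ℝ))
    (h0 : ∀ k, ∫ x, b x x k ∂stdGauss ι = 0) {p : ℕ} (hp : p ≠ 0) :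
    ∫ x, (b x x ⬝ᵥ b x x) ^ p ∂stdGauss ι
      ≤ 4 ^ p * ∫ z, (b z.1 z.2 ⬝ᵥ b z.1 z.2) ^ p ∂(stdGauss ι).prod (stdGauss ι) := by
  set γ := stdGauss ι
  have m1 : ∀ i, HasMoments (fun z : (ι → ℝ) × (ι → ℝ) => z.1 i) (γ.prod γ) :=
    fun i => (hasMoments_coord i).fst
  have m2 : ∀ i, HasMoments (fun z : (ι → ℝ) × (ι → ℝ) => z.2 i) (γ.prod γ) :=
    fun i => (hasMoments_coord i).snd
  have m11 := HasMoments.bilin b m1 m1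
  have m22 := HasMoments.bilin b m2 m2
  have m12 := HasMoments.bilin b m1 m2
  have m21 := HasMoments.bilin b m2 m1
  have s11 := (HasMoments.dotProduct m11 m11)
  -- Independence and centering: integrating out the second variable leaves the mean of `b y y`,
  -- which is zero.
  have cross : ∫ z : (ι → ℝ) × (ι → ℝ), (b z.1 z.1 ⬝ᵥ b z.1 z.1) ^ (p - 1)
      * (b z.1 z.1 ⬝ᵥ b z.2 z.2) ∂γ.prod γ = 0 := by
    simp only [dotProduct.eq_1 (b _ _) (b (Prod.snd _) _), Finset.mul_sum, ← mul_assoc]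
    rw [integral_finsetSum]
    · refine Finset.sum_eq_zero fun k _ => ?_
      rw [integral_prod_mul (fun x => (b x x ⬝ᵥ b x x) ^ (p - 1) * b x x k) (fun y => b y y k),
        h0, mul_zero]
    · intro k _
      exact (((s11.pow _).mul (m11 k)).mul (m22 k)).integrable
  -- Subtracting an independent centered copy can only increase the moment: the tangent bound at `s
  -- = ‖b x x‖²`, `t = ‖b y y - b x x‖²` has the first-order term `‖b y y‖² - 2⟨b x x, b y y⟩`,
  -- whose first part is nonnegative and whose second part averages out.
  have step1 : ∫ x, (b x x ⬝ᵥ b x x) ^ p ∂γ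
      ≤ ∫ z : (ι → ℝ) × (ι → ℝ),
        ((b z.2 z.2 - b z.1 z.1) ⬝ᵥ (b z.2 z.2 - b z.1 z.1)) ^ p ∂γ.prod γ := by
    have e : ∫ x, (b x x ⬝ᵥ b x x) ^ p ∂γ = ∫ z : (ι → ℝ) × (ι → ℝ),
        ((b z.1 z.1 ⬝ᵥ b z.1 z.1) ^ p - (2 * p) * ((b z.1 z.1 ⬝ᵥ b z.1 z.1) ^ (p - 1)
      * (b z.1 z.1 ⬝ᵥ b z.2 z.2))) ∂γ.prod γ := by
      rw [integral_sub, integral_const_mul, cross, mul_zero, sub_zero,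
        integral_fun_fst (fun x => (b x x ⬝ᵥ b x x) ^ p)]
      · simp
      · exact (s11.pow p).integrable
      · exact (((s11.pow _).mul (HasMoments.dotProduct m11 m22)).const_mul _).integrable
    rw [e]
    have md : ∀ k, HasMoments (fun z : (ι → ℝ) × (ι → ℝ) => (b z.2 z.2 - b z.1 z.1) k) (γ.prod γ) :=
      fun k => (m22 k).sub (m11 k)
    refine integral_mono
      ((s11.pow p).sub (((s11.pow _).mul (HasMoments.dotProduct m11 m22)).const_mul _)).integrable
      ((HasMoments.dotProduct md md).pow p).integrable fun z => ?_
    have hs := dotProduct_self_nonneg_real (b z.1 z.1)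
    have ht := dotProduct_self_nonneg_real (b z.2 z.2)
    refine le_trans ?_ (pow_add_mul_sub_le_pow hs
      (dotProduct_self_nonneg_real (b z.2 z.2 - b z.1 z.1)) p)
    simp only [sub_dotProduct, dotProduct_sub, dotProduct_comm (b z.2 z.2) (b z.1 z.1)]
    have h3 : 0 ≤ (p : ℝ) * (b z.1 z.1 ⬝ᵥ b z.1 z.1) ^ (p - 1) * (b z.2 z.2 ⬝ᵥ b z.2 z.2) := by
      positivity
    linear_combination h3
  refine step1.trans ?_
  set G : (ι → ℝ) × (ι → ℝ) → ℝ := fun z => (b z.1 z.2 ⬝ᵥ b z.1 z.2) ^ p with hG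
  have mG : HasMoments G (γ.prod γ) := (HasMoments.dotProduct m12 m12).pow p
  have mG' : HasMoments (fun z => G z.swap) (γ.prod γ) := (HasMoments.dotProduct m21 m21).pow p
  let R : (ι → ℝ) × (ι → ℝ) → (ι → ℝ) × (ι → ℝ) :=
    fun z => ((√2 / 2) • (z.1 + z.2), (√2 / 2) • (z.2 - z.1))
  have hR : MeasurePreserving R (γ.prod γ) (γ.prod γ) := measurePreserving_rotation
  have pt : ∀ z : (ι → ℝ) × (ι → ℝ),
      ((b z.2 z.2 - b z.1 z.1) ⬝ᵥ (b z.2 z.2 - b z.1 z.1)) ^ p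
        ≤ (4 ^ p / 2) * (G (R z) + G (R z).swap) := by
    intro z
    set v := b (R z).1 (R z).2 with hv
    set w := b (R z).2 (R z).1 with hw
    have h2 : (√2 / 2) * (√2 / 2) = 1 / 2 := by
      rw [div_mul_div_comm, Real.mul_self_sqrt (by norm_num)]; norm_num
    -- In the rotated variables the difference of the diagonal values is a sum of two off-diagonal
    -- ones, `b x' y' + b y' x'`, with `x'`, `y'` again independent.
    have hvw : b z.2 z.2 - b z.1 z.1 = v + w := by
      have : v + w = (2 * ((√2 / 2) * (√2 / 2))) • (b z.2 z.2 - b z.1 z.1) := by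
        simp only [hv, hw, R, map_smul, LinearMap.smul_apply, map_add, map_sub,
          LinearMap.add_apply, LinearMap.sub_apply]
        module
      rw [this, h2]
      norm_num
    have hle : (v + w) ⬝ᵥ (v + w) ≤ 2 * (v ⬝ᵥ v + w ⬝ᵥ w) := by
      have := dotProduct_self_nonneg_real (v - w)
      simp only [sub_dotProduct, dotProduct_sub, add_dotProduct, dotProduct_add] at this ⊢
      linarith
    rw [hvw]
    have hv0 := dotProduct_self_nonneg_real v
    have hw0 := dotProduct_self_nonneg_real w
    obtain ⟨q, rfl⟩ := Nat.exists_eq_succ_of_ne_zero hp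
    calc ((v + w) ⬝ᵥ (v + w)) ^ (q + 1)
        ≤ (2 * (v ⬝ᵥ v + w ⬝ᵥ w)) ^ (q + 1) :=
          pow_le_pow_left₀ (dotProduct_self_nonneg_real _) hle _
      _ = 2 ^ (q + 1) * (v ⬝ᵥ v + w ⬝ᵥ w) ^ (q + 1) := mul_pow _ _ _
      _ ≤ 2 ^ (q + 1) * (2 ^ q * ((v ⬝ᵥ v) ^ (q + 1) + (w ⬝ᵥ w) ^ (q + 1))) := by
          gcongr
          simpa using add_pow_le hv0 hw0 (q + 1)
      _ = (4 ^ (q + 1) / 2) * ((v ⬝ᵥ v) ^ (q + 1) + (w ⬝ᵥ w) ^ (q + 1)) := by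
          rw [show (4 : ℝ) = 2 * 2 by norm_num, mul_pow]; ring
  have md : ∀ k, HasMoments (fun z : (ι → ℝ) × (ι → ℝ) => (b z.2 z.2 - b z.1 z.1) k) (γ.prod γ) :=
    fun k => (m22 k).sub (m11 k)
  calc _ ≤ ∫ z, (4 ^ p / 2) * (G (R z) + G (R z).swap) ∂γ.prod γ :=
        integral_mono ((HasMoments.dotProduct md md).pow p).integrable
          (((mG.comp hR).add (mG'.comp hR)).const_mul _).integrable pt
    _ = 4 ^ p * ∫ z, G z ∂γ.prod γ := by
        rw [integral_const_mul, integral_add (mG.comp hR).integrable (mG'.comp hR).integrable,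
          mG.integral_comp hR, mG'.integral_comp hR, integral_prod_swap]
        ring

end Decoupling

/-! ### Moments of linear and quadratic functions of the sketch -/

section SketchMoments

open scoped Kronecker

variable {d D : ℕ}

theorem hasMoments_toMat_mulVec (v : Fin D → ℝ) (j : Fin d) :
    HasMoments (fun x => (toMat x *ᵥ v) j) (stdGauss (Fin d × Fin D)) :=
  HasMoments.dotProduct (fun k => hasMoments_coord (j, k)) fun _ => HasMoments.const _

theorem hasMoments_toMat_transpose_mulVec (u : Fin d → ℝ) (k : Fin D) :
    HasMoments (fun x => ((toMat x)ᵀ *ᵥ u) k) (stdGauss (Fin d × Fin D)) :=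
  HasMoments.dotProduct (fun j => hasMoments_coord (j, k)) fun _ => HasMoments.const _

theorem integral_dotProduct_self_pow_le (m p : ℕ) :
    ∫ u, (u ⬝ᵥ u) ^ p ∂stdGauss (Fin m) ≤ ((m : ℝ) + 2 * p) ^ p := by
  have h := integral_quadForm_pow_le (B := (1 : Matrix (Fin m) (Fin m) ℝ)) (t := m) (b := 1)
    Matrix.isSymm_one (fun x => by simpa using dotProduct_self_nonneg_real x) (by simp)
    zero_le_one (by simp) (le_refl p)
  simpa using h

/-- The sum is the quadratic form of `1 ⊗ M` with `M = ∑ aᵢaᵢᵀ`, whose trace is `d·tr M`. Since `M ≤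
tr M`, also `M² ≤ (tr M) M`. -/
theorem integral_sum_toMat_mulVec_pow_le {α : Type*} [Fintype α] (a : α → Fin D → ℝ) (p : ℕ) :
    ∫ x, (∑ i, (toMat x *ᵥ a i) ⬝ᵥ (toMat x *ᵥ a i)) ^ p ∂stdGauss (Fin d × Fin D)
      ≤ (((d : ℝ) + 2 * p) * ∑ i, a i ⬝ᵥ a i) ^ p := by
  set M : Matrix (Fin D) (Fin D) ℝ := ∑ i, Matrix.vecMulVec (a i) (a i) with hM
  set s := ∑ i, a i ⬝ᵥ a i with hs
  have hs0 : 0 ≤ s := Finset.sum_nonneg fun i _ => dotProduct_self_nonneg_real (a i)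
  have hMs : M.IsSymm := by
    rw [hM, Matrix.IsSymm, Matrix.transpose_sum]
    exact Finset.sum_congr rfl fun i _ => isSymm_vecMulVec (a i)
  have qM : ∀ v, v ⬝ᵥ M *ᵥ v = ∑ i, (a i ⬝ᵥ v) ^ 2 := by
    intro v
    simp only [hM, Matrix.sum_mulVec, dotProduct_sum, dotProduct_vecMulVec_mulVec]
  have qM0 : ∀ v, 0 ≤ v ⬝ᵥ M *ᵥ v := fun v => by
    rw [qM]; exact Finset.sum_nonneg fun i _ => sq_nonneg _
  have qMs : ∀ v, v ⬝ᵥ M *ᵥ v ≤ s * (v ⬝ᵥ v) := fun v => by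
    rw [qM, hs, Finset.sum_mul]
    exact Finset.sum_le_sum fun i _ => sq_dotProduct_le _ _
  have form : ∀ x : Fin d × Fin D → ℝ, x ⬝ᵥ ((1 : Matrix (Fin d) (Fin d) ℝ) ⊗ₖ M) *ᵥ x
      = ∑ i, (toMat x *ᵥ a i) ⬝ᵥ (toMat x *ᵥ a i) := by
    intro x
    rw [dotProduct_one_kronecker_mulVec]
    simp only [qM]
    rw [Finset.sum_comm]
    refine Finset.sum_congr rfl fun i _ => Finset.sum_congr rfl fun j _ => ?_
    rw [dotProduct_comm, sq]; rfl
  have h := integral_quadForm_pow_le (B := (1 : Matrix (Fin d) (Fin d) ℝ) ⊗ₖ M) (t := d * s)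
    (b := s) (isSymm_kronecker Matrix.isSymm_one hMs)
    (fun x => by
      rw [dotProduct_one_kronecker_mulVec]; exact Finset.sum_nonneg fun j _ => qM0 _)
    (by
      rw [Matrix.trace_kronecker, hM, Matrix.trace_sum]
      simp [Matrix.trace_vecMulVec, hs])
    hs0
    (fun x => by
      rw [← Matrix.mul_kronecker_mul, one_mul, dotProduct_one_kronecker_mulVec,
        dotProduct_one_kronecker_mulVec, Finset.mul_sum _ _ s]
      refine Finset.sum_le_sum fun j _ => ?_
      rw [hMs.dotProduct_mulVec_mulVec]
      exact hMs.mulVec_dotProduct_mulVec_le qM0 hs0 qMs _) (le_refl p)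
  simp only [form] at h
  refine h.trans (le_of_eq ?_)
  ring

/-- The moment bound for `uuᵀ ⊗ A`, of trace `‖u‖² tr A`, whose square is at most `‖u‖²‖A‖` times
itself. -/
theorem integral_quadForm_transpose_mulVec_pow_le {A : Matrix (Fin D) (Fin D) ℝ} (hA : A.IsSymm)
    (h0 : ∀ v, 0 ≤ v ⬝ᵥ A *ᵥ v) (u : Fin d → ℝ) (p : ℕ) :
    ∫ x, (((toMat x)ᵀ *ᵥ u) ⬝ᵥ A *ᵥ ((toMat x)ᵀ *ᵥ u)) ^ p ∂stdGauss (Fin d × Fin D)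
      ≤ (u ⬝ᵥ u) ^ p * (A.trace + 2 * p * specNorm A) ^ p := by
  have hu := dotProduct_self_nonneg_real u
  have h := integral_quadForm_pow_le (B := Matrix.vecMulVec u u ⊗ₖ A) (t := (u ⬝ᵥ u) * A.trace)
    (b := (u ⬝ᵥ u) * specNorm A) (isSymm_kronecker (isSymm_vecMulVec u) hA)
    (fun x => by rw [dotProduct_vecMulVec_kronecker_mulVec]; exact h0 _)
    (by rw [Matrix.trace_kronecker, Matrix.trace_vecMulVec])
    (mul_nonneg hu (specNorm_nonneg A))
    (fun x => by
      rw [← Matrix.mul_kronecker_mul, Matrix.vecMulVec_mul_vecMulVec, Matrix.vecMulVec_smul,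
        Matrix.smul_kronecker, Matrix.smul_mulVec, dotProduct_smul,
        dotProduct_vecMulVec_kronecker_mulVec, dotProduct_vecMulVec_kronecker_mulVec, smul_eq_mul,
        hA.dotProduct_mulVec_mulVec, mul_assoc]
      exact mul_le_mul_of_nonneg_left (mulVec_dotProduct_mulVec_le_of_nonneg hA h0 _) hu)
    (le_refl p)
  simp only [dotProduct_vecMulVec_kronecker_mulVec] at h
  refine h.trans (le_of_eq ?_)
  rw [← mul_pow]
  ring

end SketchMoments

/-! ### The positive semidefinite matrix `∑ Aᵢ²` -/

section SumSq

variable {n D : ℕ} {A : Fin n → Matrix (Fin D) (Fin D) ℝ}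

theorem isSymm_sum_sq (hA : ∀ i, (A i).IsSymm) : (∑ i, A i ^ 2).IsSymm := by
  rw [Matrix.IsSymm, Matrix.transpose_sum]
  exact Finset.sum_congr rfl fun i _ => by rw [Matrix.transpose_pow, (hA i).eq]

theorem dotProduct_sum_sq_mulVec (hA : ∀ i, (A i).IsSymm) (v : Fin D → ℝ) :
    v ⬝ᵥ (∑ i, A i ^ 2) *ᵥ v = ∑ i, (A i *ᵥ v) ⬝ᵥ (A i *ᵥ v) := by
  simp only [Matrix.sum_mulVec, dotProduct_sum, sq, (hA _).dotProduct_mulVec_mulVec]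

theorem dotProduct_sum_sq_mulVec_nonneg (hA : ∀ i, (A i).IsSymm) (v : Fin D → ℝ) :
    0 ≤ v ⬝ᵥ (∑ i, A i ^ 2) *ᵥ v := by
  rw [dotProduct_sum_sq_mulVec hA]
  exact Finset.sum_nonneg fun i _ => dotProduct_self_nonneg_real _

end SumSq

/-! ### Expected spectral norm of the sketched sum of squares -/

section SpectralNorm

open scoped Kronecker

variable {n d D : ℕ}

/-- The bilinear map `(X, Y) ↦ (X Aᵢ Yᵀ u)ᵢ`. -/
noncomputable def sketchBilin (A : Fin n → Matrix (Fin D) (Fin D) ℝ) (u : Fin d → ℝ) :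
    (Fin d × Fin D → ℝ) →ₗ[ℝ] (Fin d × Fin D → ℝ) →ₗ[ℝ] (Fin n × Fin d → ℝ) :=
  LinearMap.mk₂ ℝ (fun x y p => (toMat x *ᵥ (A p.1 *ᵥ ((toMat y)ᵀ *ᵥ u))) p.2)
    (fun x x' y => by
      ext p
      have : toMat (x + x') = toMat x + toMat x' := rfl
      simp [this, Matrix.add_mulVec, Matrix.add_mul])
    (fun c x y => by
      ext p
      have : toMat (c • x) = c • toMat x := rfl
      simp only [this, Matrix.smul_mulVec, Pi.smul_apply])
    (fun x y y' => by
      ext p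
      have : toMat (y + y') = toMat y + toMat y' := rfl
      simp [this, Matrix.add_mulVec, Matrix.mulVec_add])
    (fun c x y => by
      ext p
      have : toMat (c • y) = c • toMat y := rfl
      simp [this, Matrix.smul_mulVec, Matrix.mulVec_smul])

theorem sketchBilin_dotProduct (A : Fin n → Matrix (Fin D) (Fin D) ℝ) (u : Fin d → ℝ)
    (x y : Fin d × Fin D → ℝ) :
    sketchBilin A u x y ⬝ᵥ sketchBilin A u x y
      = ∑ i, (toMat x *ᵥ (A i *ᵥ ((toMat y)ᵀ *ᵥ u))) ⬝ᵥ (toMat x *ᵥ (A i *ᵥ ((toMat y)ᵀ *ᵥ u))) := by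
  rw [dotProduct, Fintype.sum_prod_type]; rfl

/-- The sum of the squares of the sketched matrices. -/
def sketchSumSq (A : Fin n → Matrix (Fin D) (Fin D) ℝ) (S : Matrix (Fin d) (Fin D) ℝ) :
    Matrix (Fin d) (Fin d) ℝ := ∑ i, (S * A i * Sᵀ) ^ 2

theorem isSymm_sketch {A : Matrix (Fin D) (Fin D) ℝ} (hA : A.IsSymm)
    (S : Matrix (Fin d) (Fin D) ℝ) : (S * A * Sᵀ).IsSymm := by
  simp [Matrix.IsSymm, Matrix.transpose_mul, hA.eq, Matrix.mul_assoc]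

theorem dotProduct_sketchSumSq_mulVec {A : Fin n → Matrix (Fin D) (Fin D) ℝ}
    (hA : ∀ i, (A i).IsSymm) (u : Fin d → ℝ) (x : Fin d × Fin D → ℝ) :
    u ⬝ᵥ sketchSumSq A (toMat x) *ᵥ u = sketchBilin A u x x ⬝ᵥ sketchBilin A u x x := by
  rw [sketchSumSq, dotProduct_sum_sq_mulVec fun i => isSymm_sketch (hA i) _,
    sketchBilin_dotProduct]
  simp only [Matrix.mulVec_mulVec, Matrix.mul_assoc]

/-- Each coordinate is the quadratic form of `(eⱼuᵀ) ⊗ Aᵢ`, whose trace contains the factor `tr Aᵢ =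
0`. This is the centering that decoupling needs. -/
theorem integral_sketchBilin_self {A : Fin n → Matrix (Fin D) (Fin D) ℝ}
    (htr : ∀ i, (A i).trace = 0) (u : Fin d → ℝ) (p : Fin n × Fin d) :
    ∫ x, sketchBilin A u x x p ∂stdGauss (Fin d × Fin D) = 0 := by
  have e : ∀ x, sketchBilin A u x x p
      = x ⬝ᵥ (Matrix.vecMulVec (Pi.single p.2 1) u ⊗ₖ A p.1) *ᵥ x := by
    intro x
    have h : (toMat x)ᵀ *ᵥ u = ∑ j, u j • toMat x j := by
      ext k; simp [Matrix.mulVec, dotProduct, mul_comm]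
    rw [dotProduct_kronecker_mulVec, Finset.sum_eq_single p.2]
    · change toMat x p.2 ⬝ᵥ (A p.1 *ᵥ ((toMat x)ᵀ *ᵥ u)) = _
      rw [h, Matrix.mulVec_sum, dotProduct_sum]
      simp [Matrix.mulVec_smul, Matrix.vecMulVec_apply]
    · intro j _ hj
      simp [Matrix.vecMulVec_apply, hj]
    · simp
  simp only [e]
  rw [integral_quadForm, Matrix.trace_kronecker, htr, mul_zero]

/-- After decoupling (factor `4^d`), integrating over the left factor for a fixed right factor gives
`(d + 2d)^d` times a power of a quadratic form of `∑ Aᵢ²`, which is then integrated over the right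
factor; `12 = 4·3`. -/
theorem integral_dotProduct_sketchSumSq_pow_le {A : Fin n → Matrix (Fin D) (Fin D) ℝ}
    (hA : ∀ i, (A i).IsSymm) (htr : ∀ i, (A i).trace = 0) (hd : d ≠ 0) (u : Fin d → ℝ) :
    ∫ x, (u ⬝ᵥ sketchSumSq A (toMat x) *ᵥ u) ^ d ∂stdGauss (Fin d × Fin D)
      ≤ (12 * d * ((∑ i, A i ^ 2).trace + 2 * d * specNorm (∑ i, A i ^ 2))) ^ d
        * (u ⬝ᵥ u) ^ d := by
  simp only [dotProduct_sketchSumSq_mulVec hA]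
  refine (integral_bilin_self_pow_le (sketchBilin A u)
    (integral_sketchBilin_self htr u) hd).trans ?_
  set γ := stdGauss (Fin d × Fin D)
  have m12 := HasMoments.bilin (sketchBilin A u) (μ := γ.prod γ) (f := Prod.fst) (g := Prod.snd)
    (fun i => (hasMoments_coord i).fst) fun i => (hasMoments_coord i).snd
  have mG := (HasMoments.dotProduct m12 m12).pow d
  have hq : ∀ v : Fin D → ℝ, ∑ i, (A i *ᵥ v) ⬝ᵥ (A i *ᵥ v) = v ⬝ᵥ (∑ i, A i ^ 2) *ᵥ v :=
    fun v => (dotProduct_sum_sq_mulVec hA v).symm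
  rw [integral_prod_symm _ mG.integrable]
  have mq : HasMoments (fun y : Fin d × Fin D → ℝ =>
      ((toMat y)ᵀ *ᵥ u) ⬝ᵥ (∑ i, A i ^ 2) *ᵥ ((toMat y)ᵀ *ᵥ u)) γ :=
    HasMoments.dotProduct (hasMoments_toMat_transpose_mulVec u) fun k =>
      HasMoments.dotProduct (fun _ => HasMoments.const _) (hasMoments_toMat_transpose_mulVec u)
  have h1 : ∫ y, ∫ x, (sketchBilin A u x y ⬝ᵥ sketchBilin A u x y) ^ d ∂γ ∂γ
      ≤ ∫ y, (3 * d) ^ d * (((toMat y)ᵀ *ᵥ u) ⬝ᵥ (∑ i, A i ^ 2) *ᵥ ((toMat y)ᵀ *ᵥ u)) ^ d ∂γ := by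
    refine integral_mono mG.integrable.integral_prod_right ((mq.pow d).const_mul _).integrable
      fun y => ?_
    simp only [sketchBilin_dotProduct]
    refine (integral_sum_toMat_mulVec_pow_le (fun i => A i *ᵥ ((toMat y)ᵀ *ᵥ u)) d).trans
      (le_of_eq ?_)
    simp only [hq]
    rw [← mul_pow]
    ring
  have h2 := integral_quadForm_transpose_mulVec_pow_le (d := d) (isSymm_sum_sq hA)
    (dotProduct_sum_sq_mulVec_nonneg hA) u d
  calc _ ≤ 4 ^ d * ((3 * d) ^ d * ((u ⬝ᵥ u) ^ d
        * ((∑ i, A i ^ 2).trace + 2 * d * specNorm (∑ i, A i ^ 2)) ^ d)) := by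
        refine mul_le_mul_of_nonneg_left (h1.trans ?_) (by positivity)
        rw [integral_const_mul]
        exact mul_le_mul_of_nonneg_left h2 (by positivity)
    _ = _ := by
        rw [← mul_pow, ← mul_pow, ← mul_pow, ← mul_pow]
        ring

theorem continuous_specNorm {m : ℕ} :
    Continuous (specNorm : Matrix (Fin m) (Fin m) ℝ → ℝ) := by
  have h : Continuous (Matrix.toEuclideanCLM (n := Fin m) (𝕜 := ℝ)) :=
    LinearMap.continuous_of_finiteDimensional
      (Matrix.toEuclideanCLM (n := Fin m) (𝕜 := ℝ)).toAlgEquiv.toLinearMap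
  exact h.norm

theorem self_pow_le_three_pow_mul_factorial (d : ℕ) :
    (d : ℝ) ^ d ≤ 3 ^ d * d.factorial := by
  have h := Real.pow_div_factorial_le_exp (d : ℝ) (by positivity) d
  rw [div_le_iff₀ (by positivity)] at h
  refine h.trans ?_
  gcongr
  rw [← Real.exp_one_pow]
  gcongr
  exact Real.exp_one_lt_three.le

theorem integral_specNorm_sketchSumSq_le {A : Fin n → Matrix (Fin D) (Fin D) ℝ}
    (hA : ∀ i, (A i).IsSymm) (htr : ∀ i, (A i).trace = 0) (hd : d ≠ 0) :
    Integrable (fun x => specNorm (sketchSumSq A (toMat x))) (stdGauss (Fin d × Fin D)) ∧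
    ∫ x, specNorm (sketchSumSq A (toMat x)) ∂stdGauss (Fin d × Fin D)
      ≤ 108 * d * ((∑ i, A i ^ 2).trace + 2 * d * specNorm (∑ i, A i ^ 2)) := by
  set K := (∑ i, A i ^ 2).trace + 2 * d * specNorm (∑ i, A i ^ 2) with hK
  set γ := stdGauss (Fin d × Fin D)
  set ρ := stdGauss (Fin d)
  have hK0 : 0 ≤ K := by
    have : 0 ≤ (∑ i, A i ^ 2).trace := by
      rw [← integral_quadForm]
      exact integral_nonneg (dotProduct_sum_sq_mulVec_nonneg hA)
    have := specNorm_nonneg (∑ i, A i ^ 2)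
    positivity
  have hnn : ∀ x u, 0 ≤ u ⬝ᵥ sketchSumSq A (toMat x) *ᵥ u := fun x u => by
    rw [dotProduct_sketchSumSq_mulVec (d := d) hA]; exact dotProduct_self_nonneg_real _
  have hsym : ∀ S : Matrix (Fin d) (Fin D) ℝ, (sketchSumSq A S).IsSymm := fun S =>
    isSymm_sum_sq fun i => isSymm_sketch (hA i) S
  have mF : HasMoments (fun z : (Fin d × Fin D → ℝ) × (Fin d → ℝ) =>
      z.2 ⬝ᵥ sketchSumSq A (toMat z.1) *ᵥ z.2) (γ.prod ρ) := by
    simp only [dotProduct_sketchSumSq_mulVec hA, sketchBilin_dotProduct]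
    have hx : ∀ j k, HasMoments (fun z : (Fin d × Fin D → ℝ) × (Fin d → ℝ) => toMat z.1 j k)
        (γ.prod ρ) := fun j k => (hasMoments_coord (j, k)).fst
    have h1 : ∀ k, HasMoments (fun z : (Fin d × Fin D → ℝ) × (Fin d → ℝ) =>
        ((toMat z.1)ᵀ *ᵥ z.2) k) (γ.prod ρ) := fun k =>
      HasMoments.dotProduct (fun j => hx j k) fun j => (hasMoments_coord j).snd
    have h2 : ∀ i k, HasMoments (fun z : (Fin d × Fin D → ℝ) × (Fin d → ℝ) =>
        (A i *ᵥ ((toMat z.1)ᵀ *ᵥ z.2)) k) (γ.prod ρ) := fun i k =>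
      HasMoments.dotProduct (fun j => HasMoments.const _) h1
    have h3 : ∀ i j, HasMoments (fun z : (Fin d × Fin D → ℝ) × (Fin d → ℝ) =>
        (toMat z.1 *ᵥ (A i *ᵥ ((toMat z.1)ᵀ *ᵥ z.2))) j) (γ.prod ρ) := fun i j =>
      HasMoments.dotProduct (hx j) (h2 i)
    exact HasMoments.sum _ fun i => HasMoments.dotProduct (h3 i) (h3 i)
  have iF := (mF.pow d).integrable
  set J := fun x => ∫ u, (u ⬝ᵥ sketchSumSq A (toMat x) *ᵥ u) ^ d ∂ρ with hJ
  have iJ : Integrable J γ := iF.integral_prod_left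
  have hf : (0 : ℝ) < d.factorial := by exact_mod_cast d.factorial_pos
  have hle : ∀ x, specNorm (sketchSumSq A (toMat x)) ^ d ≤ J x / d.factorial := fun x => by
    rw [le_div_iff₀ hf]
    exact specNorm_pow_mul_factorial_le (hsym _) (hnn x) hd
  have hcont : Continuous fun x : Fin d × Fin D → ℝ => specNorm (sketchSumSq A (toMat x)) := by
    refine continuous_specNorm.comp ?_
    have : Continuous (toMat : (Fin d × Fin D → ℝ) → Matrix (Fin d) (Fin D) ℝ) :=
      continuous_matrix fun j k => continuous_apply (j, k)
    unfold sketchSumSq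
    fun_prop
  have iN : Integrable (fun x => specNorm (sketchSumSq A (toMat x))) γ := by
    -- Domination by `J / d! + 1`: a nonnegative number is at most `1` or at most its `d`-th power.
    refine Integrable.mono' ((iJ.div_const d.factorial).add (integrable_const 1))
      hcont.aestronglyMeasurable (Filter.Eventually.of_forall fun x => ?_)
    have h0 := specNorm_nonneg (sketchSumSq A (toMat x))
    rw [Real.norm_of_nonneg h0, Pi.add_apply]
    rcases le_total (specNorm (sketchSumSq A (toMat x))) 1 with h | h
    · have := (pow_nonneg h0 d).trans (hle x)
      linarith
    · have := (le_self_pow₀ h hd).trans (hle x)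
      linarith
  refine ⟨iN, ?_⟩
  set m := ∫ x, specNorm (sketchSumSq A (toMat x)) ∂γ with hm
  have hm0 : 0 ≤ m := integral_nonneg fun x => specNorm_nonneg _
  -- Jensen for `t^d`, via the tangent line at the mean `m`.
  have hmJ : m ^ d ≤ (∫ x, J x ∂γ) / d.factorial := by
    have : ∫ x, (m ^ d + d * m ^ (d - 1) * (specNorm (sketchSumSq A (toMat x)) - m)) ∂γ
        ≤ ∫ x, J x / d.factorial ∂γ :=
      integral_mono ((integrable_const _).add ((iN.sub (integrable_const m)).const_mul _))
        (iJ.div_const _) fun x =>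
        (pow_add_mul_sub_le_pow hm0 (specNorm_nonneg _) d).trans (hle x)
    have iN' : Integrable (fun x => specNorm (sketchSumSq A (toMat x)) - m) γ :=
      iN.sub (integrable_const m)
    rw [integral_div, integral_add (integrable_const _) (iN'.const_mul _), integral_const_mul,
      integral_sub iN (integrable_const m), ← hm] at this
    simpa using this
  -- Fubini lets the chaos bound act at fixed `u`; then `E‖u‖^(2d) ≤ (d + 2d)^d`. Together with `d^d
  -- ≤ 3^d d!` this makes the constant `12·3·3 = 108`.
  have hJle : ∫ x, J x ∂γ ≤ (12 * d * K) ^ d * (3 * d) ^ d := by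
    calc ∫ x, J x ∂γ = ∫ u, ∫ x, (u ⬝ᵥ sketchSumSq A (toMat x) *ᵥ u) ^ d ∂γ ∂ρ :=
          integral_integral_swap iF
      _ ≤ ∫ u, (12 * d * K) ^ d * (u ⬝ᵥ u) ^ d ∂ρ :=
          integral_mono iF.integral_prod_right
            (((HasMoments.dotProduct hasMoments_coord hasMoments_coord).pow d).const_mul _).integrable
            fun u => integral_dotProduct_sketchSumSq_pow_le hA htr hd u
      _ ≤ _ := by
          rw [integral_const_mul]
          refine mul_le_mul_of_nonneg_left ((integral_dotProduct_self_pow_le d d).trans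
            (le_of_eq ?_)) (by positivity)
          ring
  refine le_of_pow_le_pow_left₀ hd (by positivity) ?_
  rw [le_div_iff₀ hf] at hmJ
  have h3 := self_pow_le_three_pow_mul_factorial d
  refine le_of_mul_le_mul_right ?_ hf
  calc m ^ d * d.factorial ≤ (12 * d * K) ^ d * (3 * d) ^ d := hmJ.trans hJle
    _ = (36 * d * K) ^ d * d ^ d := by rw [← mul_pow, ← mul_pow]; ring
    _ ≤ (36 * d * K) ^ d * (3 ^ d * d.factorial) := by gcongr
    _ = _ := by rw [← mul_assoc, ← mul_pow]; ring

end SpectralNorm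

/-! ### Compression of a matrix to the complement of a unit vector -/

section ProjectionAlgebra

variable {D : ℕ} {A : Matrix (Fin D) (Fin D) ℝ} {y : Fin D → ℝ}

/-- The projection onto the orthogonal complement of a unit vector `y`. -/
def orthProj (y : Fin D → ℝ) : Matrix (Fin D) (Fin D) ℝ := 1 - Matrix.vecMulVec y y

theorem isSymm_orthProj (y : Fin D → ℝ) : (orthProj y).IsSymm := by
  simp [Matrix.IsSymm, orthProj, Matrix.transpose_vecMulVec]

theorem orthProj_mulVec (y v : Fin D → ℝ) : orthProj y *ᵥ v = v - (y ⬝ᵥ v) • y := by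
  simp [orthProj, Matrix.sub_mulVec, Matrix.vecMulVec_mulVec]

theorem vecMulVec_mul_self (hy : y ⬝ᵥ y = 1) :
    Matrix.vecMulVec y y * Matrix.vecMulVec y y = Matrix.vecMulVec y y := by
  rw [Matrix.vecMulVec_mul_vecMulVec, hy, one_smul]

theorem orthProj_mul_self (hy : y ⬝ᵥ y = 1) : orthProj y * orthProj y = orthProj y := by
  simp [orthProj, mul_sub, sub_mul, vecMulVec_mul_self hy]

theorem trace_vecMulVec_mul (y : Fin D → ℝ) (N : Matrix (Fin D) (Fin D) ℝ) :
    (Matrix.vecMulVec y y * N).trace = y ⬝ᵥ N *ᵥ y := by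
  rw [Matrix.trace_mul_comm, Matrix.mul_vecMulVec, Matrix.trace_vecMulVec, dotProduct_comm]

theorem isSymm_orthProj_mul_mul (hA : A.IsSymm) (y : Fin D → ℝ) :
    (orthProj y * A * orthProj y).IsSymm := by
  simp [Matrix.IsSymm, Matrix.transpose_mul, hA.eq, (isSymm_orthProj y).eq, Matrix.mul_assoc]

theorem trace_orthProj_mul_mul (hy : y ⬝ᵥ y = 1) (htr : A.trace = 0) :
    (orthProj y * A * orthProj y).trace = -(y ⬝ᵥ A *ᵥ y) := by
  rw [Matrix.trace_mul_comm, ← Matrix.mul_assoc, orthProj_mul_self hy, orthProj, sub_mul, one_mul,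
    Matrix.trace_sub, htr, trace_vecMulVec_mul, zero_sub]

theorem sq_dotProduct_mulVec_le_of_unit (hy : y ⬝ᵥ y = 1) (A : Matrix (Fin D) (Fin D) ℝ) :
    (y ⬝ᵥ A *ᵥ y) ^ 2 ≤ (A *ᵥ y) ⬝ᵥ (A *ᵥ y) := by
  simpa [hy] using sq_dotProduct_le y (A *ᵥ y)

/-- Expanding gives `tr (PAP)² = tr A² - 2‖Ay‖² + (yᵀAy)²`, and `(yᵀAy)² ≤ ‖Ay‖²`. -/
theorem trace_orthProj_mul_mul_sq_le (hA : A.IsSymm) (hy : y ⬝ᵥ y = 1) :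
    ((orthProj y * A * orthProj y) * (orthProj y * A * orthProj y)).trace ≤ (A * A).trace := by
  have h1 : ((orthProj y * A * orthProj y) * (orthProj y * A * orthProj y)).trace
      = (orthProj y * A * (orthProj y * A)).trace := by
    calc _ = (orthProj y * (A * (orthProj y * orthProj y) * A * orthProj y)).trace := by
          simp only [Matrix.mul_assoc]
      _ = (A * orthProj y * A * (orthProj y * orthProj y)).trace := by
          rw [Matrix.trace_mul_comm]; simp only [orthProj_mul_self hy, Matrix.mul_assoc]
      _ = _ := by
          rw [orthProj_mul_self hy, Matrix.trace_mul_comm]; simp only [Matrix.mul_assoc]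
  have h2 : orthProj y * A * (orthProj y * A) = A * A - A * Matrix.vecMulVec y y * A
      - Matrix.vecMulVec y y * (A * A)
      + Matrix.vecMulVec y y * (A * Matrix.vecMulVec y y * A) := by
    simp only [orthProj]; noncomm_ring
  have h3 : (A * Matrix.vecMulVec y y * A).trace = (A *ᵥ y) ⬝ᵥ (A *ᵥ y) := by
    rw [Matrix.mul_assoc, Matrix.trace_mul_comm, Matrix.mul_assoc, trace_vecMulVec_mul,
      hA.dotProduct_mulVec_mulVec]
  have h4 : y ⬝ᵥ (A * Matrix.vecMulVec y y * A) *ᵥ y = (y ⬝ᵥ A *ᵥ y) ^ 2 := by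
    rw [← Matrix.mulVec_mulVec, ← Matrix.mulVec_mulVec, Matrix.vecMulVec_mulVec]
    simp [Matrix.mulVec_smul, dotProduct_smul, sq]
  rw [h1, h2, Matrix.trace_add, Matrix.trace_sub, Matrix.trace_sub, h3, trace_vecMulVec_mul,
    trace_vecMulVec_mul, h4, hA.dotProduct_mulVec_mulVec]
  have := sq_dotProduct_mulVec_le_of_unit hy A
  have := dotProduct_self_nonneg_real (A *ᵥ y)
  linarith

theorem orthProj_mulVec_dotProduct_self_le (hy : y ⬝ᵥ y = 1) (w : Fin D → ℝ) :
    (orthProj y *ᵥ w) ⬝ᵥ (orthProj y *ᵥ w) ≤ w ⬝ᵥ w := by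
  simp only [orthProj_mulVec, sub_dotProduct, dotProduct_sub, smul_dotProduct, dotProduct_smul,
    hy, smul_eq_mul, dotProduct_comm w y]
  nlinarith [sq_nonneg (y ⬝ᵥ w)]

end ProjectionAlgebra

/-! ### Conditioning on the sketched vector: mean and variance -/

section Resampling

open scoped Kronecker

variable {d D : ℕ}

/-- The quadratic form `⟨(X y)(X y)ᵀ, X A Xᵀ⟩` in the entries of `X`. -/
def sketchQuad (A : Matrix (Fin D) (Fin D) ℝ) (y : Fin D → ℝ) (x : Fin d × Fin D → ℝ) : ℝ :=
  ((toMat x)ᵀ *ᵥ (toMat x *ᵥ y)) ⬝ᵥ A *ᵥ ((toMat x)ᵀ *ᵥ (toMat x *ᵥ y))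

/-- Replace the part of the rows of `z.1` orthogonal to `y` by that of `z.2`. -/
noncomputable def resample (y : Fin D → ℝ) (z : (Fin d × Fin D → ℝ) × (Fin d × Fin D → ℝ)) :
    Fin d × Fin D → ℝ :=
  ((1 : Matrix (Fin d) (Fin d) ℝ) ⊗ₖ Matrix.vecMulVec y y) *ᵥ z.1
    + ((1 : Matrix (Fin d) (Fin d) ℝ) ⊗ₖ orthProj y) *ᵥ z.2

/-- `yyᵀ` and `P` are complementary orthogonal projections, so the covariances add up to the
identity. -/
theorem measurePreserving_resample {y : Fin D → ℝ} (hy : y ⬝ᵥ y = 1) :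
    MeasurePreserving (resample (d := d) y)
      ((stdGauss (Fin d × Fin D)).prod (stdGauss (Fin d × Fin D))) (stdGauss (Fin d × Fin D)) := by
  refine measurePreserving_mulVec_add_mulVec ?_
  rw [(isSymm_kronecker Matrix.isSymm_one (isSymm_vecMulVec y)).eq,
    (isSymm_kronecker Matrix.isSymm_one (isSymm_orthProj y)).eq, ← Matrix.mul_kronecker_mul,
    ← Matrix.mul_kronecker_mul, vecMulVec_mul_self hy, orthProj_mul_self hy, one_mul,
    ← Matrix.kronecker_add, show Matrix.vecMulVec y y + orthProj y = 1 from add_sub_cancel _ _,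
    Matrix.one_kronecker_one]

theorem toMat_resample (y : Fin D → ℝ) (z : (Fin d × Fin D → ℝ) × (Fin d × Fin D → ℝ)) :
    toMat (resample y z)
      = toMat z.1 * Matrix.vecMulVec y y + toMat z.2 * orthProj y := by
  ext j k
  have h : ∀ (M : Matrix (Fin D) (Fin D) ℝ), M.IsSymm → ∀ x : Fin d × Fin D → ℝ,
      (((1 : Matrix (Fin d) (Fin d) ℝ) ⊗ₖ M) *ᵥ x) (j, k) = (toMat x * M) j k := by
    intro M hM x
    rw [kronecker_mulVec_apply, Matrix.one_mulVec, Matrix.mul_apply]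
    change ∑ k', M k k' * toMat x j k' = _
    refine Finset.sum_congr rfl fun k' _ => ?_
    rw [mul_comm, hM.apply k k']
  simp only [resample, toMat, Matrix.of_apply, Pi.add_apply, Matrix.add_apply]
  rw [h _ (isSymm_vecMulVec y), h _ (isSymm_orthProj y)]
  rfl

/-- Resampling keeps `Xy = g`, while `Xᵀg` becomes `‖g‖² y + Pq`; the form of `A` is expanded there.
-/
theorem sketchQuad_resample {A : Matrix (Fin D) (Fin D) ℝ} (hA : A.IsSymm) {y : Fin D → ℝ}
    (hy : y ⬝ᵥ y = 1) (x h : Fin d × Fin D → ℝ) {g : Fin d → ℝ} (hg : toMat x *ᵥ y = g)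
    {q : Fin D → ℝ} (hq : (toMat h)ᵀ *ᵥ g = q) :
    sketchQuad A y (resample y (x, h)) = (g ⬝ᵥ g) ^ 2 * (y ⬝ᵥ A *ᵥ y)
      + 2 * (g ⬝ᵥ g) * ((orthProj y *ᵥ (A *ᵥ y)) ⬝ᵥ q)
      + q ⬝ᵥ (orthProj y * A * orthProj y) *ᵥ q := by
  have h1 : toMat (resample y (x, h)) *ᵥ y = g := by
    rw [toMat_resample, Matrix.add_mulVec, ← Matrix.mulVec_mulVec, ← Matrix.mulVec_mulVec,
      orthProj_mulVec, Matrix.vecMulVec_mulVec]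
    simp [hy, hg]
  have h2 : (toMat (resample y (x, h)))ᵀ *ᵥ g = (g ⬝ᵥ g) • y + orthProj y *ᵥ q := by
    rw [toMat_resample, Matrix.transpose_add, Matrix.add_mulVec, Matrix.transpose_mul,
      Matrix.transpose_mul, ← Matrix.mulVec_mulVec, ← Matrix.mulVec_mulVec,
      (isSymm_vecMulVec y).eq, (isSymm_orthProj y).eq, hq, Matrix.vecMulVec_mulVec]
    congr 1
    rw [Matrix.mulVec_transpose, dotProduct_comm, ← Matrix.dotProduct_mulVec, hg]
    simp
  have h3 : (orthProj y *ᵥ q) ⬝ᵥ A *ᵥ y = (orthProj y *ᵥ (A *ᵥ y)) ⬝ᵥ q := by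
    rw [dotProduct_comm, (isSymm_orthProj y).dotProduct_mulVec_comm, dotProduct_comm]
  have h4 : (orthProj y *ᵥ q) ⬝ᵥ A *ᵥ (orthProj y *ᵥ q)
      = q ⬝ᵥ (orthProj y * A * orthProj y) *ᵥ q := by
    rw [dotProduct_comm, (isSymm_orthProj y).dotProduct_mulVec_comm, Matrix.mulVec_mulVec,
      Matrix.mulVec_mulVec, Matrix.mul_assoc]
  rw [sketchQuad, h1, h2]
  simp only [Matrix.mulVec_add, Matrix.mulVec_smul, dotProduct_add, add_dotProduct,
    smul_dotProduct, dotProduct_smul, smul_eq_mul, hA.dotProduct_mulVec_comm y (orthProj y *ᵥ q),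
    h3, h4]
  ring

theorem hasMoments_sketchQuad (A : Matrix (Fin D) (Fin D) ℝ) (y : Fin D → ℝ) :
    HasMoments (sketchQuad (d := d) A y) (stdGauss (Fin d × Fin D)) := by
  have h1 : ∀ k, HasMoments (fun x : Fin d × Fin D → ℝ => ((toMat x)ᵀ *ᵥ (toMat x *ᵥ y)) k)
      (stdGauss (Fin d × Fin D)) := fun k =>
    HasMoments.dotProduct (fun j => hasMoments_coord (j, k)) (hasMoments_toMat_mulVec y)
  exact HasMoments.dotProduct h1 fun k => HasMoments.dotProduct (fun _ => HasMoments.const _) h1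

theorem integral_dotProduct_transpose_mulVec (w : Fin D → ℝ) (g : Fin d → ℝ) :
    ∫ h, w ⬝ᵥ ((toMat h)ᵀ *ᵥ g) ∂stdGauss (Fin d × Fin D) = 0 := by
  have e : ∀ h : Fin d × Fin D → ℝ,
      w ⬝ᵥ ((toMat h)ᵀ *ᵥ g) = ∑ k, ∑ j, w k * g j * h (j, k) := by
    intro h
    simp only [dotProduct, Matrix.mulVec, Finset.mul_sum]
    refine Finset.sum_congr rfl fun k _ => Finset.sum_congr rfl fun j _ => ?_
    simp only [Matrix.transpose_apply, toMat, Matrix.of_apply]; ring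
  simp only [e]
  rw [integral_finsetSum _ fun k _ =>
    (HasMoments.sum _ fun j => (hasMoments_coord (j, k)).const_mul _).integrable]
  refine Finset.sum_eq_zero fun k _ => ?_
  rw [integral_finsetSum _ fun j _ => ((hasMoments_coord (j, k)).const_mul _).integrable]
  refine Finset.sum_eq_zero fun j _ => ?_
  rw [integral_const_mul, integral_coord, mul_zero]

theorem integral_quadForm_transpose_mulVec (B : Matrix (Fin D) (Fin D) ℝ) (g : Fin d → ℝ) :
    ∫ h, ((toMat h)ᵀ *ᵥ g) ⬝ᵥ B *ᵥ ((toMat h)ᵀ *ᵥ g) ∂stdGauss (Fin d × Fin D)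
      = (g ⬝ᵥ g) * B.trace := by
  simp only [← dotProduct_vecMulVec_kronecker_mulVec]
  rw [integral_quadForm, Matrix.trace_kronecker, Matrix.trace_vecMulVec]

theorem integral_quadForm_transpose_mulVec_sq {B : Matrix (Fin D) (Fin D) ℝ} (hB : B.IsSymm)
    (g : Fin d → ℝ) :
    ∫ h, (((toMat h)ᵀ *ᵥ g) ⬝ᵥ B *ᵥ ((toMat h)ᵀ *ᵥ g)) ^ 2 ∂stdGauss (Fin d × Fin D)
      = (g ⬝ᵥ g) ^ 2 * (B.trace ^ 2 + 2 * (B * B).trace) := by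
  simp only [← dotProduct_vecMulVec_kronecker_mulVec]
  rw [integral_quadForm_sq (isSymm_kronecker (isSymm_vecMulVec g) hB), ← Matrix.mul_kronecker_mul,
    Matrix.trace_kronecker, Matrix.trace_kronecker, Matrix.trace_vecMulVec,
    Matrix.vecMulVec_mul_vecMulVec, Matrix.trace_vecMulVec, dotProduct_smul, smul_eq_mul]
  ring

theorem integral_dotProduct_transpose_mulVec_sq (w : Fin D → ℝ) (g : Fin d → ℝ) :
    ∫ h, (w ⬝ᵥ ((toMat h)ᵀ *ᵥ g)) ^ 2 ∂stdGauss (Fin d × Fin D) = (g ⬝ᵥ g) * (w ⬝ᵥ w) := by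
  simp only [← dotProduct_vecMulVec_mulVec]
  rw [integral_quadForm_transpose_mulVec, Matrix.trace_vecMulVec]

/-- The moments of the squared norm of a sketched unit vector. -/
theorem integral_sketch_norm_pow_succ {y : Fin D → ℝ} (hy : y ⬝ᵥ y = 1) (p : ℕ) :
    ∫ x, ((toMat x *ᵥ y) ⬝ᵥ (toMat x *ᵥ y)) ^ (p + 1) ∂stdGauss (Fin d × Fin D)
      = ((d : ℝ) + 2 * p)
        * ∫ x, ((toMat x *ᵥ y) ⬝ᵥ (toMat x *ᵥ y)) ^ p ∂stdGauss (Fin d × Fin D) := by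
  have e : ∀ x : Fin d × Fin D → ℝ, (toMat x *ᵥ y) ⬝ᵥ (toMat x *ᵥ y)
      = x ⬝ᵥ ((1 : Matrix (Fin d) (Fin d) ℝ) ⊗ₖ Matrix.vecMulVec y y) *ᵥ x := by
    intro x
    rw [dotProduct_one_kronecker_mulVec]
    refine Finset.sum_congr rfl fun j _ => ?_
    rw [dotProduct_vecMulVec_mulVec, dotProduct_comm, sq]; rfl
  simp only [e]
  -- `1 ⊗ yyᵀ` is a projection of trace `d`, so the recursion closes on the same form.
  rw [integral_quadForm_pow_succ (isSymm_kronecker Matrix.isSymm_one (isSymm_vecMulVec y)),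
    ← Matrix.mul_kronecker_mul, one_mul, vecMulVec_mul_self hy, Matrix.trace_kronecker,
    Matrix.trace_vecMulVec, hy, Matrix.trace_one]
  rcases p with _ | p
  · simp
  · simp only [Nat.add_sub_cancel, ← pow_succ, Fintype.card_fin]
    ring

/-- The linear term averages to zero and the quadratic one to `-‖g‖² a`, leaving `(E‖g‖⁴ - E‖g‖²) a
= (d² + 2d - d) a`. -/
theorem integral_sketchQuad {A : Matrix (Fin D) (Fin D) ℝ} (hA : A.IsSymm) (htr : A.trace = 0)
    {y : Fin D → ℝ} (hy : y ⬝ᵥ y = 1) :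
    ∫ x, sketchQuad A y x ∂stdGauss (Fin d × Fin D)
      = ((d : ℝ) ^ 2 + d) * (y ⬝ᵥ A *ᵥ y) := by
  set γ := stdGauss (Fin d × Fin D)
  have hR := measurePreserving_resample (d := d) hy
  have mf := hasMoments_sketchQuad (d := d) A y
  have mg : HasMoments (fun x : Fin d × Fin D → ℝ => (toMat x *ᵥ y) ⬝ᵥ (toMat x *ᵥ y)) γ :=
    HasMoments.dotProduct (hasMoments_toMat_mulVec y) (hasMoments_toMat_mulVec y)
  have inner : ∀ x, ∫ h, sketchQuad A y (resample y (x, h)) ∂γ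
      = ((toMat x *ᵥ y) ⬝ᵥ (toMat x *ᵥ y)) ^ 2 * (y ⬝ᵥ A *ᵥ y)
        - ((toMat x *ᵥ y) ⬝ᵥ (toMat x *ᵥ y)) * (y ⬝ᵥ A *ᵥ y) := by
    intro x
    simp only [sketchQuad_resample hA hy x _ rfl rfl]
    set g := toMat x *ᵥ y
    have mq := hasMoments_toMat_transpose_mulVec (D := D) g
    have ml : HasMoments (fun h => (orthProj y *ᵥ (A *ᵥ y)) ⬝ᵥ ((toMat h)ᵀ *ᵥ g)) γ :=
      HasMoments.dotProduct (fun _ => HasMoments.const _) mq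
    have mQ : HasMoments (fun h => ((toMat h)ᵀ *ᵥ g) ⬝ᵥ (orthProj y * A * orthProj y) *ᵥ
        ((toMat h)ᵀ *ᵥ g)) γ :=
      HasMoments.dotProduct mq fun k => HasMoments.dotProduct (fun _ => HasMoments.const _) mq
    rw [integral_add ((HasMoments.const _).add (ml.const_mul _)).integrable mQ.integrable,
      integral_add (integrable_const _) (ml.const_mul _).integrable, integral_const_mul (2 * g ⬝ᵥ g),
      integral_dotProduct_transpose_mulVec, integral_quadForm_transpose_mulVec,
      trace_orthProj_mul_mul hy htr]
    simp
    ring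
  have r0 := integral_sketch_norm_pow_succ (d := d) hy 0
  have r1 := integral_sketch_norm_pow_succ (d := d) hy 1
  simp only [zero_add, pow_one, pow_zero, Nat.reduceAdd, integral_const, probReal_univ,
    smul_eq_mul, mul_one, Nat.cast_zero, mul_zero, add_zero, Nat.cast_one] at r0 r1
  rw [r0] at r1
  calc _ = ∫ z, sketchQuad A y (resample y z) ∂γ.prod γ := by
        exact (mf.integral_comp hR).symm
    _ = ∫ x, ∫ h, sketchQuad A y (resample y (x, h)) ∂γ ∂γ :=
        integral_prod _ (mf.comp hR).integrable
    _ = _ := by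
        simp only [inner]
        rw [integral_sub ((mg.pow 2).mul (HasMoments.const _)).integrable
          (mg.mul (HasMoments.const _)).integrable, integral_mul_const, integral_mul_const, r0, r1]
        ring

theorem variance_sketchQuad_le {A : Matrix (Fin D) (Fin D) ℝ} (hA : A.IsSymm)
    (htr : A.trace = 0) {y : Fin D → ℝ} (hy : y ⬝ᵥ y = 1) (hd : 0 < d) :
    variance (sketchQuad A y) (stdGauss (Fin d × Fin D))
      ≤ 632 * (d ^ 3 * ((A *ᵥ y) ⬝ᵥ (A *ᵥ y)) + d ^ 2 * (A * A).trace) := by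
  set γ := stdGauss (Fin d × Fin D)
  set a := y ⬝ᵥ A *ᵥ y with ha
  set w := orthProj y *ᵥ (A *ᵥ y) with hw
  set B := orthProj y * A * orthProj y with hB
  have hR := measurePreserving_resample (d := d) hy
  have mf := hasMoments_sketchQuad (d := d) A y
  have mg : HasMoments (fun x : Fin d × Fin D → ℝ => (toMat x *ᵥ y) ⬝ᵥ (toMat x *ᵥ y)) γ :=
    HasMoments.dotProduct (hasMoments_toMat_mulVec y) (hasMoments_toMat_mulVec y)
  set r : (Fin d × Fin D → ℝ) → ℝ := fun x => (toMat x *ᵥ y) ⬝ᵥ (toMat x *ᵥ y) with hr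
  set E := ∫ x, sketchQuad A y x ∂γ with hE
  have hE' : E = ((d : ℝ) ^ 2 + d) * a := integral_sketchQuad hA htr hy
  have mF : HasMoments (fun x => (sketchQuad A y x - E) ^ 2) γ :=
    (mf.sub (HasMoments.const E)).pow 2
  have r1 : ∫ x, r x ∂γ = d := by
    simpa using integral_sketch_norm_pow_succ (d := d) hy 0
  have r2 : ∫ x, r x ^ 2 ∂γ = (d + 2) * d := by
    have := integral_sketch_norm_pow_succ (d := d) hy 1
    simp only [pow_one] at this
    rw [r1] at this
    rw [this]; norm_num
  have r3 : ∫ x, r x ^ 3 ∂γ = (d + 4) * ((d + 2) * d) := by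
    have := integral_sketch_norm_pow_succ (d := d) hy 2
    rw [r2] at this
    rw [this]; norm_num
  have r4 : ∫ x, r x ^ 4 ∂γ = (d + 6) * ((d + 4) * ((d + 2) * d)) := by
    have := integral_sketch_norm_pow_succ (d := d) hy 3
    rw [r3] at this
    rw [this]; norm_num
  have inner : ∀ x, ∫ h, (sketchQuad A y (resample y (x, h)) - E) ^ 2 ∂γ
      ≤ 4 * a ^ 2 * r x ^ 4 + 16 * (w ⬝ᵥ w) * r x ^ 3
        + (8 * (B * B).trace + 4 * a ^ 2 - 8 * (d ^ 2 + 2 * d) * a ^ 2) * r x ^ 2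
        + -8 * d * a ^ 2 * r x + 4 * ((d ^ 2 + 2 * d) ^ 2 + d ^ 2) * a ^ 2 := by
    intro x
    simp only [sketchQuad_resample hA hy x _ rfl rfl, ← ha, ← hw, ← hB]
    have hrx : (toMat x *ᵥ y) ⬝ᵥ (toMat x *ᵥ y) = r x := rfl
    simp only [hrx]
    set g := toMat x *ᵥ y with hg
    have mq := hasMoments_toMat_transpose_mulVec (D := D) g
    have ml : HasMoments (fun h => w ⬝ᵥ ((toMat h)ᵀ *ᵥ g)) γ :=
      HasMoments.dotProduct (fun _ => HasMoments.const _) mq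
    have mQ : HasMoments (fun h => ((toMat h)ᵀ *ᵥ g) ⬝ᵥ B *ᵥ ((toMat h)ᵀ *ᵥ g)) γ :=
      HasMoments.dotProduct mq fun k => HasMoments.dotProduct (fun _ => HasMoments.const _) mq
    set l := fun h : Fin d × Fin D → ℝ => w ⬝ᵥ ((toMat h)ᵀ *ᵥ g) with hl
    set Q := fun h : Fin d × Fin D → ℝ => ((toMat h)ᵀ *ᵥ g) ⬝ᵥ B *ᵥ ((toMat h)ᵀ *ᵥ g) with hQ
    have il : ∫ h, l h ^ 2 ∂γ = r x * (w ⬝ᵥ w) := integral_dotProduct_transpose_mulVec_sq w g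
    have iQ1 : ∫ h, Q h ∂γ = r x * -a := by
      have := integral_quadForm_transpose_mulVec B g
      rwa [hB, trace_orthProj_mul_mul hy htr] at this
    have iQ2 : ∫ h, Q h ^ 2 ∂γ = r x ^ 2 * ((-a) ^ 2 + 2 * (B * B).trace) := by
      have := integral_quadForm_transpose_mulVec_sq (isSymm_orthProj_mul_mul hA y) g
      rwa [trace_orthProj_mul_mul hy htr] at this
    have m1 := (ml.pow 2).const_mul (16 * r x ^ 2)
    have m2 := (mQ.pow 2).const_mul 4
    have m3 := mQ.const_mul (8 * r x * a)
    set c := 4 * ((r x ^ 2 - (d ^ 2 + 2 * d)) ^ 2 * a ^ 2 + r x ^ 2 * a ^ 2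
        + (r x - d) ^ 2 * a ^ 2) with hc
    calc ∫ h, (r x ^ 2 * a + 2 * r x * l h + Q h - E) ^ 2 ∂γ
        ≤ ∫ h, (16 * r x ^ 2 * l h ^ 2 + 4 * Q h ^ 2 + 8 * r x * a * Q h + c) ∂γ := by
          refine integral_mono (((((HasMoments.const _).add (ml.const_mul _)).add mQ).sub
            (HasMoments.const E)).pow 2).integrable
            (((m1.add m2).add m3).add (HasMoments.const c)).integrable fun h => ?_
          -- With `r = ‖g‖²`, all four summands are centered: `E r² = d² + 2d`, `E r = d`, and given
          -- `g` the form `Q` has mean `-ra`. Their squares can thus be bounded separately at the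
          -- cost of a factor 4.
          have e : r x ^ 2 * a + 2 * r x * l h + Q h - E
              = (r x ^ 2 - (d ^ 2 + 2 * d)) * a + 2 * r x * l h + (Q h + r x * a)
                - (r x - d) * a := by rw [hE']; ring
          have four : ∀ α β δ ε : ℝ, (α + β + δ - ε) ^ 2 ≤ 4 * (α ^ 2 + β ^ 2 + δ ^ 2 + ε ^ 2) := by
            intro α β δ ε
            nlinarith [sq_nonneg (α - β), sq_nonneg (α - δ), sq_nonneg (α + ε), sq_nonneg (β - δ),
              sq_nonneg (β + ε), sq_nonneg (δ + ε)]
          dsimp only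
          rw [e]
          refine (four _ _ _ _).trans (le_of_eq ?_)
          rw [hc]; ring
      _ = _ := by
          rw [integral_add ((m1.add m2).add m3).integrable (integrable_const _),
            integral_add (m1.add m2).integrable m3.integrable,
            integral_add m1.integrable m2.integrable, integral_const_mul, integral_const_mul,
            integral_const_mul, il, iQ1, iQ2]
          simp only [integral_const, probReal_univ, smul_eq_mul, one_mul, hc]
          ring
  have m4 := (mg.pow 4).const_mul (4 * a ^ 2)
  have m3 := (mg.pow 3).const_mul (16 * (w ⬝ᵥ w))
  have m2 := (mg.pow 2).const_mul
    (8 * (B * B).trace + 4 * a ^ 2 - 8 * ((d : ℝ) ^ 2 + 2 * d) * a ^ 2)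
  have m1 := mg.const_mul (-8 * d * a ^ 2)
  have m0 := HasMoments.const (μ := γ) (4 * (((d : ℝ) ^ 2 + 2 * d) ^ 2 + d ^ 2) * a ^ 2)
  have mz := mF.comp hR
  -- The four variances are `Var(r²) = (d² + 2d)(8d + 24)` times `a²`, then `4‖w‖² E r³`, `2 tr B² ·
  -- E r²`, and `Var(r) a² = 2d a²`.
  have bound : variance (sketchQuad A y) γ ≤ 4 * (((d : ℝ) ^ 2 + 2 * d) * (8 * d + 24) * a ^ 2
      + 4 * (w ⬝ᵥ w) * ((d + 4) * ((d + 2) * d)) + 2 * (B * B).trace * ((d + 2) * d)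
      + 2 * d * a ^ 2) := by
    calc variance (sketchQuad A y) γ = ∫ x, (sketchQuad A y x - E) ^ 2 ∂γ :=
          variance_eq_integral mf.integrable.aestronglyMeasurable.aemeasurable
      _ = ∫ z, (sketchQuad A y (resample y z) - E) ^ 2 ∂γ.prod γ := (mF.integral_comp hR).symm
      _ = ∫ x, ∫ h, (sketchQuad A y (resample y (x, h)) - E) ^ 2 ∂γ ∂γ :=
          integral_prod _ mz.integrable
      _ ≤ _ := integral_mono mz.integrable.integral_prod_left
          ((((m4.add m3).add m2).add m1).add m0).integrable inner
      _ = _ := by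
          rw [integral_add (((m4.add m3).add m2).add m1).integrable m0.integrable,
            integral_add ((m4.add m3).add m2).integrable m1.integrable,
            integral_add (m4.add m3).integrable m2.integrable,
            integral_add m4.integrable m3.integrable, integral_const_mul, integral_const_mul,
            integral_const_mul, integral_const_mul, r1, r2, r3, r4]
          simp only [integral_const, probReal_univ, smul_eq_mul, one_mul]
          ring
  have hd1 : (1 : ℝ) ≤ d := by exact_mod_cast hd
  have ha2 : a ^ 2 ≤ (A *ᵥ y) ⬝ᵥ (A *ᵥ y) := sq_dotProduct_mulVec_le_of_unit hy A
  have hw2 : w ⬝ᵥ w ≤ (A *ᵥ y) ⬝ᵥ (A *ᵥ y) := orthProj_mulVec_dotProduct_self_le hy _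
  have hT : (B * B).trace ≤ (A * A).trace := trace_orthProj_mul_mul_sq_le hA hy
  have hV := dotProduct_self_nonneg_real (A *ᵥ y)
  have hT0 : 0 ≤ (A * A).trace := by
    rw [← integral_quadForm]
    exact integral_nonneg fun v => by
      rw [hA.dotProduct_mulVec_mulVec]; exact dotProduct_self_nonneg_real _
  set V := (A *ᵥ y) ⬝ᵥ (A *ᵥ y)
  have hd2 : (d : ℝ) ≤ d ^ 2 := by nlinarith
  have hd3 : (d : ℝ) ^ 2 ≤ d ^ 3 := by nlinarith [sq_nonneg (d : ℝ)]
  -- Crude bounds valid for `d ≥ 1`; the coefficient of `d³‖Ay‖²` becomes `4·(96 + 60 + 2) = 632`.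
  have c1 : ((d : ℝ) ^ 2 + 2 * d) * (8 * d + 24) ≤ 96 * d ^ 3 := by nlinarith
  have c2 : ((d : ℝ) + 4) * ((d + 2) * d) ≤ 15 * d ^ 3 := by nlinarith
  have c3 : ((d : ℝ) + 2) * d ≤ 3 * d ^ 2 := by nlinarith
  have b1 : ((d : ℝ) ^ 2 + 2 * d) * (8 * d + 24) * a ^ 2 ≤ 96 * d ^ 3 * V := by gcongr
  have b2 : 4 * (w ⬝ᵥ w) * (((d : ℝ) + 4) * ((d + 2) * d)) ≤ 4 * V * (15 * d ^ 3) := by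
    gcongr
  have b3 : 2 * (B * B).trace * (((d : ℝ) + 2) * d) ≤ 2 * (A * A).trace * (3 * d ^ 2) := by
    gcongr
  have b4 : 2 * (d : ℝ) * a ^ 2 ≤ 2 * d ^ 3 * V := by
    gcongr
    linarith
  have b5 : 0 ≤ (d : ℝ) ^ 2 * (A * A).trace := by positivity
  linarith

end Resampling

/-! ### Scaling back from standard Gaussian entries -/

section Transfer

variable {n d D : ℕ}

theorem matInner_outerSelf (y : Fin D → ℝ) (N : Matrix (Fin D) (Fin D) ℝ) :
    matInner (outerSelf y) N = y ⬝ᵥ N *ᵥ y := trace_vecMulVec_mul y N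

theorem sketchForm_smul (A : Matrix (Fin D) (Fin D) ℝ) (y : EuclideanSpace ℝ (Fin D)) (c : ℝ)
    (x : Fin d × Fin D → ℝ) :
    sketchForm A y (c • toMat x) = c ^ 4 * sketchQuad A y.ofLp x := by
  have h : ∀ g : Fin d → ℝ, g ⬝ᵥ (toMat x * A * (toMat x)ᵀ) *ᵥ g
      = ((toMat x)ᵀ *ᵥ g) ⬝ᵥ A *ᵥ ((toMat x)ᵀ *ᵥ g) := by
    intro g
    rw [Matrix.mul_assoc, ← Matrix.mulVec_mulVec, Matrix.dotProduct_mulVec,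
      ← Matrix.mulVec_transpose, ← Matrix.mulVec_mulVec]
  rw [sketchForm, matInner_outerSelf, sketchQuad, ← h]
  simp only [Matrix.smul_mulVec, Matrix.transpose_smul, Matrix.smul_mul, Matrix.mul_smul,
    Matrix.mulVec_smul, smul_dotProduct, dotProduct_smul, smul_eq_mul]
  ring

theorem specNorm_smul {m : ℕ} (c : ℝ) (M : Matrix (Fin m) (Fin m) ℝ) :
    specNorm (c • M) = |c| * specNorm M := by
  rw [specNorm, map_smul, norm_smul, Real.norm_eq_abs, specNorm]

theorem specNorm_sketchSumSq_smul (A : Fin n → Matrix (Fin D) (Fin D) ℝ) (c : ℝ)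
    (S : Matrix (Fin d) (Fin D) ℝ) :
    specNorm (∑ i, ((c • S) * A i * (c • S)ᵀ) ^ 2) = c ^ 4 * specNorm (sketchSumSq A S) := by
  have : ∑ i, ((c • S) * A i * (c • S)ᵀ) ^ 2 = c ^ 4 • sketchSumSq A S := by
    rw [sketchSumSq, Finset.smul_sum]
    refine Finset.sum_congr rfl fun i _ => ?_
    simp only [Matrix.transpose_smul, Matrix.smul_mul, Matrix.mul_smul, smul_smul, smul_pow]
    congr 1
    ring
  rw [this, specNorm_smul, abs_of_nonneg (by positivity)]

/-- The entries of a Gaussian sketch, normalized to have variance one. -/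
theorem IsGaussianSketch.hasLaw_stdGauss {Ω : Type*} [MeasurableSpace Ω] {μ : Measure Ω}
    [IsProbabilityMeasure μ] {S : Ω → Matrix (Fin d) (Fin D) ℝ} (hS : IsGaussianSketch μ S)
    (hd : 0 < d) :
    HasLaw (fun ω (p : Fin d × Fin D) => √d * S ω p.1 p.2) (stdGauss (Fin d × Fin D)) μ := by
  have hd0 : (0 : ℝ) < d := by exact_mod_cast hd
  have h1 : ∀ p : Fin d × Fin D, HasLaw (fun ω => √d * S ω p.1 p.2) (gaussianReal 0 1) μ := by
    intro p
    have h := gaussianReal_const_mul (hS.hasLaw p.1 p.2) (√d)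
    have hv : (NNReal.mk (√d ^ 2) (sq_nonneg _) * (1 / (d : ℝ≥0)) : ℝ≥0) = 1 := by
      ext
      push_cast
      rw [Real.sq_sqrt hd0.le]
      field_simp
    rwa [mul_zero, hv] at h
  have hm : ∀ p : Fin d × Fin D, AEMeasurable (fun ω => √d * S ω p.1 p.2) μ :=
    fun p => (h1 p).aemeasurable
  refine ⟨aemeasurable_pi_lambda _ hm, ?_⟩
  have hi : iIndepFun (fun (p : Fin d × Fin D) ω => √d * S ω p.1 p.2) μ :=
    hS.indep.comp (fun _ t => √d * t) fun _ => by fun_prop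
  rw [(iIndepFun_iff_map_fun_eq_pi_map hm).mp hi]
  congr 1
  ext1 p
  exact (h1 p).map_eq

end Transfer

theorem mainTheorem9 :
    ∃ C : ℝ, 0 < C ∧
      ∀ (n d D : ℕ), 0 < d →
      ∀ (A : Fin n → Matrix (Fin D) (Fin D) ℝ),
        (∀ i, (A i).IsSymm) → (∀ i, (A i).trace = 0) →
      ∀ (y : EuclideanSpace ℝ (Fin D)), ‖y‖ = 1 →
      ∀ (Ω : Type*) [MeasurableSpace Ω] (μ : Measure Ω) [IsProbabilityMeasure μ]
        (S : Ω → Matrix (Fin d) (Fin D) ℝ), IsGaussianSketch μ S →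
        (∀ i, Integrable (fun ω => sketchForm (A i) y (S ω)) μ ∧
          ∫ ω, sketchForm (A i) y (S ω) ∂μ
            = (1 + 1 / (d : ℝ)) * matInner (outerSelf y.ofLp) (A i)) ∧
        ((∀ i, MemLp (fun ω => sketchForm (A i) y (S ω)) 2 μ) ∧
          ∑ i, variance (fun ω => sketchForm (A i) y (S ω)) μ
            ≤ C * (specNorm (∑ i, A i ^ 2) / d + (∑ i, A i ^ 2).trace / (d : ℝ) ^ 2)) ∧
        (Integrable (fun ω => specNorm (∑ i, (S ω * A i * (S ω)ᵀ) ^ 2)) μ ∧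
          ∫ ω, specNorm (∑ i, (S ω * A i * (S ω)ᵀ) ^ 2) ∂μ
            ≤ C * (specNorm (∑ i, A i ^ 2) + (∑ i, A i ^ 2).trace / d)) := by
  -- The variance bound dictates the constant; the spectral norm bound needs only `216 = 2·108`.
  refine ⟨632, by norm_num, ?_⟩
  intro n d D hd A hA htr y hy Ω _ μ _ S hS
  have hd0 : (0 : ℝ) < d := by exact_mod_cast hd
  have hG := hS.hasLaw_stdGauss hd
  set G : Ω → Fin d × Fin D → ℝ := fun ω p => √d * S ω p.1 p.2 with hGdef
  have hSG : ∀ ω, S ω = (√d)⁻¹ • toMat (G ω) := by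
    intro ω
    ext j k
    simp only [toMat, hGdef, Matrix.smul_apply, Matrix.of_apply, smul_eq_mul]
    rw [inv_mul_cancel_left₀ (Real.sqrt_pos.mpr hd0).ne']
  have hc : ((√d)⁻¹ : ℝ) ^ 4 = 1 / (d : ℝ) ^ 2 := by
    rw [inv_pow, show (√d : ℝ) ^ 4 = (√d ^ 2) ^ 2 by ring, Real.sq_sqrt hd0.le, one_div]
  have hyy : y.ofLp ⬝ᵥ y.ofLp = 1 := by
    rw [← norm_toLp_sq]; simp [hy]
  have form : ∀ i, (fun ω => sketchForm (A i) y (S ω))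
      = fun ω => 1 / (d : ℝ) ^ 2 * (sketchQuad (A i) y.ofLp ∘ G) ω := by
    intro i; ext ω; rw [hSG, sketchForm_smul, hc]; rfl
  have norm : (fun ω => specNorm (∑ i, (S ω * A i * (S ω)ᵀ) ^ 2))
      = fun ω => 1 / (d : ℝ) ^ 2 * ((fun x => specNorm (sketchSumSq A (toMat x))) ∘ G) ω := by
    ext ω; rw [hSG, specNorm_sketchSumSq_smul, hc]; rfl
  have hM := fun i => hasMoments_sketchQuad (d := d) (A i) y.ofLp
  have hLp : ∀ i, MemLp (sketchQuad (A i) y.ofLp ∘ G) 2 μ := fun i => by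
    have := (hM i).memLp_two
    rw [← hG.map_eq] at this
    exact this.comp_of_map hG.aemeasurable
  have hN0 := specNorm_nonneg (∑ i, A i ^ 2)
  have hT0 : 0 ≤ (∑ i, A i ^ 2).trace := by
    rw [← integral_quadForm]
    exact integral_nonneg (dotProduct_sum_sq_mulVec_nonneg hA)
  refine ⟨fun i => ⟨?_, ?_⟩, ⟨fun i => ?_, ?_⟩, ?_, ?_⟩
  · rw [form]
    exact ((hLp i).integrable one_le_two).const_mul _
  · rw [form, integral_const_mul, hG.integral_comp (hM i).integrable.aestronglyMeasurable,
      integral_sketchQuad (hA i) (htr i) hyy, matInner_outerSelf]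
    field_simp
  · rw [form]
    exact (hLp i).const_mul _
  · have hv : ∀ i, variance (fun ω => sketchForm (A i) y (S ω)) μ
        ≤ (1 / (d : ℝ) ^ 2) ^ 2 * (632 * (d ^ 3 * ((A i *ᵥ y.ofLp) ⬝ᵥ (A i *ᵥ y.ofLp))
          + d ^ 2 * (A i * A i).trace)) := by
      intro i
      rw [form, variance_const_mul]
      refine mul_le_mul_of_nonneg_left ?_ (by positivity)
      rw [← variance_map (by
        rw [hG.map_eq]; exact (hM i).integrable.aestronglyMeasurable.aemeasurable)
        hG.aemeasurable, hG.map_eq]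
      exact variance_sketchQuad_le (hA i) (htr i) hyy hd
    refine (Finset.sum_le_sum fun i _ => hv i).trans ?_
    rw [← Finset.mul_sum, ← Finset.mul_sum, Finset.sum_add_distrib, ← Finset.mul_sum,
      ← Finset.mul_sum, ← dotProduct_sum_sq_mulVec hA]
    have h1 := dotProduct_mulVec_le (∑ i, A i ^ 2) y.ofLp
    rw [hyy, mul_one] at h1
    have h2 : ∑ i, (A i * A i).trace = (∑ i, A i ^ 2).trace := by
      simp only [Matrix.trace_sum, sq]
    rw [h2]
    calc _ ≤ (1 / (d : ℝ) ^ 2) ^ 2 * (632 * (d ^ 3 * specNorm (∑ i, A i ^ 2)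
          + d ^ 2 * (∑ i, A i ^ 2).trace)) := by gcongr
      _ = _ := by field_simp
  · rw [norm]
    have := (integral_specNorm_sketchSumSq_le hA htr hd.ne').1
    rw [← hG.map_eq] at this
    exact (this.comp_aemeasurable hG.aemeasurable).const_mul _
  · have h := integral_specNorm_sketchSumSq_le hA htr hd.ne'
    rw [norm, integral_const_mul, hG.integral_comp h.1.aestronglyMeasurable]
    calc _ ≤ 1 / (d : ℝ) ^ 2 * (108 * d * ((∑ i, A i ^ 2).trace
          + 2 * d * specNorm (∑ i, A i ^ 2))) := by gcongr; exact h.2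
      _ = 216 * specNorm (∑ i, A i ^ 2) + 108 * ((∑ i, A i ^ 2).trace / d) := by
          field_simp
          ring
      _ ≤ _ := by
          have : 0 ≤ (∑ i, A i ^ 2).trace / d := by positivity
          linarith
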